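/- Let $Z=\operatorname{Spec}\mathcal O$ be a smooth irreducible affine complex algebraic variety, let $n\ge 0$, and let $0\ne f=f(x;z)\in\mathcal O[x_1^{\pm1},\dots,x_n^{\pm1}]$. Let $K=\mathbb C(\nu_0,\nu_1,\dots,\nu_n)$, write $s=\nu_0$, and let $\hbar$ be a formal parameter. For $a\in\mathbb Z^{n+1}$ let $c(\nu)\mapsto c(\nu+\hbar a)$ denote the ring endomorphism of $K[[\hbar]]$ that fixes $\hbar$ and maps $\sum_k g_k(\nu)\hbar^k$ to $\sum_k g_k(\nu+\hbar a)\hbar^k$ (Taylor expansion in $\hbar$). **The ring.** $DD_{[[\hbar]]}$ is the associative $\mathbb C$-algebra generated by $K[[\hbar]]$, by $\mathcal O$, by symbols $\theta^\hbar$ ($=\hbar\theta$), one for each vector field $\theta\in\operatorname{Der}_{\mathbb C}(\mathcal O)$, and by commuting invertible difference operators $\sigma_s=\sigma_{\nu_0},\sigma_{\nu_1},\dots,\sigma_{\nu_n}$, with $\sigma^a=\prod_i\sigma_{\nu_i}^{a_i}$ for $a\in\mathbb Z^{n+1}$, subject to the relations: $K[[\hbar]]$ and $\mathcal O$ are commuting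 $\mathbb C$-subalgebras (that is, their ring structures and their $\mathbb C$-algebra structures are respected); $(g\theta+\eta)^\hbar=g\theta^\hbar+\eta^\hbar$, $[\theta^\hbar,g]=\hbar\,\theta(g)$ and $[\theta^\hbar,\eta^\hbar]=\hbar[\theta,\eta]^\hbar$ for $g\in\mathcal O$; the $\theta^\hbar$ commute with $K[[\hbar]]$; the $\sigma^a$ commute with $\mathcal O$ and with all $\theta^\hbar$; and $\sigma^a c(\nu)=c(\nu+\hbar a)\sigma^a$ for $c\in K[[\hbar]]$, so that in particular $[\sigma_{\nu_i},\nu_j]=\delta_{ij}\hbar\sigma_{\nu_i}$. **The module.** For $p=\sum_\alpha c_\alpha(z)x^\alpha\in\mathcal O[x^{\pm1}]$ put $p(\sigma_\nu;z)=\sum_\alpha c_\alpha(z)\,\sigma_{\nu_1}^{\alpha_1}\cdots\sigma_{\nu_n}^{\alpha_n}$. Let $J_{[[\hbar]]}$ be the left ideal of $DD_{[[\hbar]]}$ generated by $$1-\sigma_s f(\sigma_\nu;z),\qquad \nu_j-s\,\sigma_s\sigma_{\nu_j}\frac{\partial f}{\partial x_j}(\sigma_\nu;z)\ (1\le j\le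 n),\qquad \theta^\hbar+s\,\sigma_s\,(\theta f)(\sigma_\nu;z)\ (\theta\in\operatorname{Der}_{\mathbb C}(\mathcal O)),$$ where $\theta$ acts on the coefficients of $f$, and let $M^{\rm hyp}_{[[\hbar]]}=DD_{[[\hbar]]}/J_{[[\hbar]]}$, a left $DD_{[[\hbar]]}$-module. **The cohomology.** Let $B=\mathcal O[x_1^{\pm1},\dots,x_n^{\pm1}][1/f]\otimes_{\mathbb C}K[[\hbar]]$, let $\Omega^k=\bigoplus_{i_1<\dots<i_k}B\,dx_{i_1}\wedge\dots\wedge dx_{i_k}$, and let $$\nabla=\hbar\,d_x+\omega\wedge\colon\Omega^k\to\Omega^{k+1},\qquad \omega=-\nu_0\frac{d_xf}{f}+\sum_{i=1}^n\nu_i\frac{dx_i}{x_i}.$$ Let $H^n((X/Z)_{K[[\hbar]]},\omega)=\Omega^n/\nabla(\Omega^{n-1})$ be the top cohomology of this complex (with $\Omega^{-1}=0$). The ring $DD_{[[\hbar]]}$ acts on $B$ by multiplication by elements of $\mathcal O$ and of $K[[\hbar]]$, by $\theta^\hbar b=\hbar\,\theta(b)-\nu_0\frac{\theta(f)}{f}b$,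 and by $\sigma^a b=f^{-a_0}x_1^{a_1}\cdots x_n^{a_n}\,b(\nu+\hbar a)$. It acts on $\Omega^k$ through the coefficients with respect to the $dx_{i_1}\wedge\dots\wedge dx_{i_k}$; this action commutes with $\nabla$, so $H^n((X/Z)_{K[[\hbar]]},\omega)$ is a left $DD_{[[\hbar]]}$-module. **Theorem.** There is an isomorphism of left $DD_{[[\hbar]]}$-modules $$M^{\rm hyp}_{[[\hbar]]}\ \xrightarrow{\ \sim\ }\ H^n((X/Z)_{K[[\hbar]]},\omega),\qquad [1]\longmapsto\left[\frac{dx_1}{x_1}\wedge\cdots\wedge\frac{dx_n}{x_n}\right]$$ (since $[1]$ generates the source, it is the only $DD_{[[\hbar]]}$-linear map with this value at $[1]$). -/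

import Mathlib

open scoped TensorProduct

noncomputable section

namespace HbarHyp

/-- The field `K = ℂ(ν₀, …, νₙ)` of rational functions in the parameters (`ν₀` is also called
`s`). -/
abbrev ParamField (n : ℕ) : Type := FractionRing (MvPolynomial (Fin (n + 1)) ℂ)

/-- The ring `K⟦ħ⟧` of formal power series in `ħ`. -/
abbrev KHbar (n : ℕ) : Type := PowerSeries (ParamField n)

/-- The formal parameter `ħ`. -/
def hbar (n : ℕ) : KHbar n := PowerSeries.X

/-- The parameter `νᵢ`, as an element of `K⟦ħ⟧`. -/
def nu {n : ℕ} (i : Fin (n + 1)) : KHbar n :=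
  PowerSeries.C (algebraMap (MvPolynomial (Fin (n + 1)) ℂ) (ParamField n) (MvPolynomial.X i))

/-- The substitution `p(ν) ↦ p(ν + ħ a)` on polynomials. -/
def shiftPoly {n : ℕ} (a : Fin (n + 1) → ℤ) : MvPolynomial (Fin (n + 1)) ℂ →ₐ[ℂ] KHbar n :=
  MvPolynomial.aeval fun i => nu i + (a i : KHbar n) * hbar n

theorem constantCoeff_shiftPoly {n : ℕ} (a : Fin (n + 1) → ℤ)
    (p : MvPolynomial (Fin (n + 1)) ℂ) :
    PowerSeries.constantCoeff (shiftPoly a p) = algebraMap _ (ParamField n) p := by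
  induction p using MvPolynomial.induction_on with
  | C c =>
    rw [show (MvPolynomial.C c : MvPolynomial (Fin (n + 1)) ℂ) = algebraMap ℂ _ c from rfl,
      AlgHom.commutes, ← IsScalarTower.algebraMap_apply,
      IsScalarTower.algebraMap_apply ℂ (ParamField n) (KHbar n)]
    exact PowerSeries.constantCoeff_C _
  | add p q hp hq => simp only [map_add, hp, hq]
  | mul_X p i hp => simp [shiftPoly, hbar, nu] at hp ⊢; simp [hp]

theorem isUnit_shiftPoly {n : ℕ} (a : Fin (n + 1) → ℤ)
    (p : nonZeroDivisors (MvPolynomial (Fin (n + 1)) ℂ)) : IsUnit (shiftPoly a p) := by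
  rw [PowerSeries.isUnit_iff_constantCoeff, constantCoeff_shiftPoly]
  exact IsLocalization.map_units (ParamField n) p

/-- The substitution `g(ν) ↦ g(ν + ħ a)` from `K` to `K⟦ħ⟧` (Taylor expansion in `ħ`). -/
def shiftK {n : ℕ} (a : Fin (n + 1) → ℤ) : ParamField n →ₐ[ℂ] KHbar n :=
  IsLocalization.liftAlgHom (M := nonZeroDivisors (MvPolynomial (Fin (n + 1)) ℂ))
    (f := shiftPoly a) (isUnit_shiftPoly a)

/-- The underlying map of the substitution `ν ↦ ν + ħ a` on `K⟦ħ⟧`: it sends `∑ₖ gₖ(ν) ħᵏ` to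
`∑ₖ gₖ(ν + ħ a) ħᵏ`. -/
def shiftFun {n : ℕ} (a : Fin (n + 1) → ℤ) (p : KHbar n) : KHbar n :=
  PowerSeries.mk fun m => ∑ k ∈ Finset.range (m + 1),
    PowerSeries.coeff (m - k) (shiftK a (PowerSeries.coeff k p))

/-- Modulo `ħᴺ` the map `shiftFun a` is given by substitution in the truncation. -/
theorem shiftFun_trunc {n : ℕ} (a : Fin (n + 1) → ℤ) (p : KHbar n) (N : ℕ) :
    (hbar n) ^ N ∣ shiftFun a p -
      (PowerSeries.trunc N p).eval₂ (shiftK a : ParamField n →+* KHbar n) (hbar n) := by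
  rw [hbar, PowerSeries.X_pow_dvd_iff]
  intro m hm
  rw [map_sub, sub_eq_zero, PowerSeries.eval₂_trunc_eq_sum_range, map_sum, shiftFun,
    PowerSeries.coeff_mk]
  simp only [PowerSeries.coeff_mul_X_pow', RingHom.coe_coe]
  rw [← Finset.sum_filter]
  apply Finset.sum_congr _ fun _ _ => rfl
  ext k
  simp only [Finset.mem_range, Finset.mem_filter]
  omega

theorem dvd_sub_trunc {n : ℕ} (p : KHbar n) (N : ℕ) :
    (hbar n) ^ N ∣ p - (PowerSeries.trunc N p : KHbar n) := by
  rw [hbar, PowerSeries.X_pow_dvd_iff]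
  intro m hm
  simp [PowerSeries.coeff_trunc, hm]

theorem hbar_pow_dvd_ext {n : ℕ} {p q : KHbar n} (h : ∀ N, (hbar n) ^ N ∣ p - q) : p = q := by
  ext m
  have := (PowerSeries.X_pow_dvd_iff.mp (h (m + 1))) m (Nat.lt_succ_self m)
  rwa [map_sub, sub_eq_zero] at this

theorem hbar_pow_dvd_eval₂ {n : ℕ} (g : ParamField n →+* KHbar n) (N : ℕ)
    {p q : Polynomial (ParamField n)}
    (h : (hbar n) ^ N ∣ (p : KHbar n) - (q : KHbar n)) :
    (hbar n) ^ N ∣ p.eval₂ g (hbar n) - q.eval₂ g (hbar n) := by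
  have h' : (Polynomial.X : Polynomial (ParamField n)) ^ N ∣ p - q := by
    rw [Polynomial.X_pow_dvd_iff]
    rw [hbar, PowerSeries.X_pow_dvd_iff] at h
    intro d hd
    simpa using h d hd
  obtain ⟨r, hr⟩ := h'
  rw [← Polynomial.eval₂_sub, hr, Polynomial.eval₂_mul, Polynomial.eval₂_pow, Polynomial.eval₂_X]
  exact dvd_mul_right _ _

/-- If a polynomial `q` agrees with `p` modulo `ħᴺ`, it computes `shiftFun a p` modulo `ħᴺ`. -/
theorem shiftFun_approx {n : ℕ} (a : Fin (n + 1) → ℤ) (p : KHbar n) (N : ℕ)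
    (q : Polynomial (ParamField n)) (h : (hbar n) ^ N ∣ p - (q : KHbar n)) :
    (hbar n) ^ N ∣ shiftFun a p -
      q.eval₂ (shiftK a : ParamField n →+* KHbar n) (hbar n) := by
  have h1 := shiftFun_trunc a p N
  have h2 : (hbar n) ^ N ∣ p - (PowerSeries.trunc N p : KHbar n) := dvd_sub_trunc p N
  have h3 := hbar_pow_dvd_eval₂ (shiftK a : ParamField n →+* KHbar n) N
    (p := PowerSeries.trunc N p) (q := q) (by simpa using dvd_sub h h2)
  simpa using dvd_add h1 h3

/-- The substitution `ν ↦ ν + ħ a`, as a ring endomorphism of `K⟦ħ⟧` fixing `ħ`. -/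
def shift {n : ℕ} (a : Fin (n + 1) → ℤ) : KHbar n →ₐ[ℂ] KHbar n :=
  AlgHom.mk' 
    { toFun := shiftFun a
      map_one' := by
        refine hbar_pow_dvd_ext fun N => ?_
        simpa using shiftFun_approx a 1 N 1 (by simp)
      map_zero' := by
        refine hbar_pow_dvd_ext fun N => ?_
        simpa using shiftFun_approx a 0 N 0 (by simp)
      map_add' := fun p q => by
        refine hbar_pow_dvd_ext fun N => ?_
        have h1 := shiftFun_trunc a p N
        have h2 := shiftFun_trunc a q N
        have h3 := shiftFun_approx a (p + q) N (PowerSeries.trunc N p + PowerSeries.trunc N q)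
          (by
            have := dvd_add (dvd_sub_trunc p N) (dvd_sub_trunc q N)
            push_cast
            convert this using 1
            ring)
        rw [Polynomial.eval₂_add] at h3
        convert dvd_sub h3 (dvd_add h1 h2) using 1
        ring
      map_mul' := fun p q => by
        refine hbar_pow_dvd_ext fun N => ?_
        have h1 := shiftFun_trunc a p N
        have h2 := shiftFun_trunc a q N
        have h3 := shiftFun_approx a (p * q) N (PowerSeries.trunc N p * PowerSeries.trunc N q)
          (by
            have := dvd_add (dvd_mul_of_dvd_left (dvd_sub_trunc p N) q)
              (dvd_mul_of_dvd_right (dvd_sub_trunc q N) (PowerSeries.trunc N p : KHbar n))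
            push_cast
            convert this using 1
            ring)
        rw [Polynomial.eval₂_mul] at h3
        have h4 := dvd_add (dvd_mul_of_dvd_left h1 (shiftFun a q))
          (dvd_mul_of_dvd_right h2
            ((PowerSeries.trunc N p).eval₂ (shiftK a : ParamField n →+* KHbar n) (hbar n)))
        convert dvd_sub h3 h4 using 1
        ring }
    fun c p => by
      refine hbar_pow_dvd_ext fun N => ?_
      have h1 := shiftFun_trunc a p N
      have h3 := shiftFun_approx a (c • p) N
        (Polynomial.C (algebraMap ℂ (ParamField n) c) * PowerSeries.trunc N p)
        (by
          have := dvd_mul_of_dvd_right (dvd_sub_trunc p N)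
            (PowerSeries.C (algebraMap ℂ (ParamField n) c))
          push_cast
          convert this using 1
          rw [Algebra.smul_def, mul_sub, PowerSeries.algebraMap_apply])
      have h4 := dvd_mul_of_dvd_right h1 (algebraMap ℂ (KHbar n) c)
      rw [Polynomial.eval₂_mul, Polynomial.eval₂_C, RingHom.coe_coe, AlgHom.commutes] at h3
      change (hbar n) ^ N ∣ shiftFun a (c • p) - c • shiftFun a p
      rw [Algebra.smul_def c (shiftFun a p)]
      convert dvd_sub h3 h4 using 1
      ring

theorem shift_apply {n : ℕ} (a : Fin (n + 1) → ℤ) (p : KHbar n) : shift a p = shiftFun a p := rfl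

theorem shift_hbar {n : ℕ} (a : Fin (n + 1) → ℤ) : shift a (hbar n) = hbar n := by
  refine hbar_pow_dvd_ext fun N => ?_
  simpa [shift_apply] using shiftFun_approx a (hbar n) N Polynomial.X (by simp [hbar])

theorem shift_C {n : ℕ} (a : Fin (n + 1) → ℤ) (c : ParamField n) :
    shift a (PowerSeries.C c) = shiftK a c := by
  refine hbar_pow_dvd_ext fun N => ?_
  simpa [shift_apply] using shiftFun_approx a (PowerSeries.C c) N (Polynomial.C c) (by simp)

theorem shift_nu {n : ℕ} (a : Fin (n + 1) → ℤ) (i : Fin (n + 1)) :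
    shift a (nu i) = nu i + (a i : KHbar n) * hbar n := by
  rw [nu, shift_C, shiftK]
  simp [shiftPoly, nu]

/-- Endomorphisms of `K⟦ħ⟧` fixing `ħ` are determined by the images of the parameters. -/
theorem endHom_ext {n : ℕ} {F G : KHbar n →ₐ[ℂ] KHbar n} (hF : F (hbar n) = hbar n)
    (hG : G (hbar n) = hbar n) (h : ∀ i, F (nu i) = G (nu i)) : F = G := by
  have hC : ∀ c : ParamField n, F (PowerSeries.C c) = G (PowerSeries.C c) := by
    let F' : ParamField n →+* KHbar n := (F : KHbar n →+* KHbar n).comp PowerSeries.C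
    let G' : ParamField n →+* KHbar n := (G : KHbar n →+* KHbar n).comp PowerSeries.C
    have : F' = G' := by
      refine IsLocalization.ringHom_ext (nonZeroDivisors (MvPolynomial (Fin (n + 1)) ℂ)) ?_
      refine MvPolynomial.ringHom_ext (fun c => ?_) fun i => h i
      have h1 := (F.commutes c).trans (G.commutes c).symm
      rw [PowerSeries.algebraMap_apply,
        IsScalarTower.algebraMap_apply ℂ (MvPolynomial (Fin (n + 1)) ℂ) (ParamField n)] at h1
      exact h1
    exact fun c => RingHom.congr_fun this c
  have hpoly : ∀ q : Polynomial (ParamField n), F (q : KHbar n) = G (q : KHbar n) := by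
    intro q
    induction q using Polynomial.induction_on' with
    | add p q hp hq => simp only [Polynomial.coe_add, map_add, hp, hq]
    | monomial k c =>
      rw [← Polynomial.C_mul_X_pow_eq_monomial, Polynomial.coe_mul, Polynomial.coe_pow,
        Polynomial.coe_C, Polynomial.coe_X, map_mul, map_mul, map_pow, map_pow, hC]
      rw [hbar] at hF hG
      rw [hF, hG]
  ext1 p
  refine hbar_pow_dvd_ext fun N => ?_
  have h1 := map_dvd F (dvd_sub_trunc p N)
  have h2 := map_dvd G (dvd_sub_trunc p N)
  rw [map_pow, hF, map_sub] at h1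
  rw [map_pow, hG, map_sub, ← hpoly] at h2
  simpa using dvd_sub h1 h2

theorem shift_zero {n : ℕ} : shift (0 : Fin (n + 1) → ℤ) = AlgHom.id ℂ (KHbar n) :=
  endHom_ext (shift_hbar _) rfl fun i => by simp [shift_nu]

theorem shift_add {n : ℕ} (a b : Fin (n + 1) → ℤ) : shift (a + b) = (shift a).comp (shift b) :=
  endHom_ext (shift_hbar _) (by simp [shift_hbar]) fun i => by
    simp [shift_nu, shift_hbar]
    ring

section Localize

variable {R : Type*} [CommRing R] [Algebra ℂ R] (M : Submonoid R)

/-- Auxiliary: the `R`-linear map `Ω[Localization M] → Localization M` induced by a derivation `D`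
of `R`. -/
def localizeDerAux (D : Derivation ℂ R R) :
    KaehlerDifferential ℂ (Localization M) →ₗ[R] Localization M :=
  IsLocalizedModule.lift M (KaehlerDifferential.map ℂ ℂ R (Localization M))
    ((Algebra.linearMap R (Localization M)).compDer D).liftKaehlerDifferential
    (IsLocalizedModule.map_units (Algebra.linearMap R (Localization M)))

/-- The unique extension of a derivation of `R` to a localization of `R`. -/
def localizeDer (D : Derivation ℂ R R) : Derivation ℂ (Localization M) (Localization M) :=
  (LinearMap.extendScalarsOfIsLocalization M (Localization M) (localizeDerAux M D)).compDer
    (KaehlerDifferential.D ℂ (Localization M))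

theorem localizeDer_algebraMap (D : Derivation ℂ R R) (p : R) :
    localizeDer M D (algebraMap _ _ p) = algebraMap _ _ (D p) := by
  change localizeDerAux M D (KaehlerDifferential.D ℂ (Localization M) (algebraMap _ _ p)) = _
  rw [← KaehlerDifferential.map_D ℂ ℂ, localizeDerAux, IsLocalizedModule.lift_apply]
  simp

end Localize


section Twisted

variable {L : Type*} [CommRing L] [Algebra ℂ L] {n : ℕ}

/-- The logarithmic derivative `D(u)/u`. -/
def dlog (D : Derivation ℂ L L) (u : Lˣ) : L := ((u⁻¹ : Lˣ) : L) * D (u : L)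

/-- The unit `∏ᵢ uᵢ^aᵢ`. -/
def unitMonomial (u : Fin (n + 1) → Lˣ) (a : Fin (n + 1) → ℤ) : Lˣ := ∏ i, u i ^ a i

theorem dlog_mul (D : Derivation ℂ L L) (u v : Lˣ) :
    dlog D (u * v) = dlog D u + dlog D v := by
  simp only [dlog, mul_inv, Units.val_mul, Derivation.leibniz, smul_eq_mul]
  linear_combination ((u⁻¹ : Lˣ) : L) * D (u : L) * v.inv_mul +
    ((v⁻¹ : Lˣ) : L) * D (v : L) * u.inv_mul

/-- `dlog` as a homomorphism. -/
def dlogHom (D : Derivation ℂ L L) :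
    Lˣ →* Multiplicative L where
  toFun u := Multiplicative.ofAdd (dlog D u)
  map_one' := by simp [dlog]
  map_mul' u v := by rw [dlog_mul, ofAdd_add]

theorem dlog_unitMonomial (u : Fin (n + 1) → Lˣ) (D : Derivation ℂ L L)
    (a : Fin (n + 1) → ℤ) :
    dlog D (unitMonomial u a) = ∑ i, a i • dlog D (u i) := by
  have := map_prod (dlogHom D) (fun i => u i ^ a i) Finset.univ
  simp only [map_zpow] at this
  exact congrArg Multiplicative.toAdd this |>.trans (by simp [toAdd_prod, dlogHom])

theorem dlog_bracket (D E : Derivation ℂ L L)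
    (u : Lˣ) : dlog ⁅D, E⁆ u = D (dlog E u) - E (dlog D u) := by
  have h : ∀ D : Derivation ℂ L L,
      D ((u⁻¹ : Lˣ) : L) =
        -((u⁻¹ : Lˣ) : L) ^ 2 * D (u : L) := fun D => by
    simpa using D.leibniz_of_mul_eq_one u.inv_mul
  simp only [dlog, Derivation.commutator_apply, Derivation.leibniz, h, smul_eq_mul]
  ring

/-- The base change `L ⊗ K⟦ħ⟧` of a `ℂ`-algebra `L`. -/
abbrev KHbarAlg (L : Type*) [CommRing L] [Algebra ℂ L] (n : ℕ) : Type _ := L ⊗[ℂ] KHbar n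

/-- The `K⟦ħ⟧`-linear extension of a derivation. -/
def tensorDer (n : ℕ) (D : Derivation ℂ L L) :
    Derivation ℂ (KHbarAlg L n) (KHbarAlg L n) :=
  Derivation.mk' (TensorProduct.map (D : L →ₗ[ℂ] L) LinearMap.id) (by
    intro a b
    induction a using TensorProduct.induction_on with
    | zero => simp
    | add a a' h h' => simp only [add_mul, map_add, h, h', smul_eq_mul, mul_add]; ring
    | tmul l c =>
      induction b using TensorProduct.induction_on with
      | zero => simp
      | add b b' h h' => simp only [mul_add, map_add, h, h', smul_eq_mul, add_mul]; ring
      | tmul l' c' =>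
        simp [Algebra.TensorProduct.tmul_mul_tmul, TensorProduct.add_tmul, mul_comm c' c])

theorem tensorDer_tmul (D : Derivation ℂ L L) (l : L)
    (c : KHbar n) : tensorDer n D (l ⊗ₜ c) = D l ⊗ₜ c := by
  simp [tensorDer]

variable (u : Fin (n + 1) → Lˣ)

/-- The contraction `ω(D) = ∑ᵢ νᵢ D(uᵢ)/uᵢ` of the logarithmic form `ω = ∑ᵢ νᵢ duᵢ/uᵢ` with a
derivation `D`. -/
def omega (D : Derivation ℂ L L) : KHbarAlg L n := ∑ i, dlog D (u i) ⊗ₜ[ℂ] nu i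

/-- The twisted covariant derivative `b ↦ ħ D(b) + ω(D) b`. -/
def conn (D : Derivation ℂ L L) : KHbarAlg L n →ₗ[ℂ] KHbarAlg L n :=
  LinearMap.mulLeft ℂ (1 ⊗ₜ hbar n) ∘ₗ (tensorDer n D).toLinearMap +
    LinearMap.mulLeft ℂ (omega u D)

theorem conn_apply (D : Derivation ℂ L L) (b : KHbarAlg L n) :
    conn u D b = (1 ⊗ₜ hbar n) * tensorDer n D b + omega u D * b := rfl

/-- The `ℂ`-algebra endomorphism of `KHbarAlg L n` given by `ν ↦ ν + ħ a` on coefficients. -/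
def shiftCoef (L : Type*) [CommRing L] [Algebra ℂ L] (a : Fin (n + 1) → ℤ) : KHbarAlg L n →ₐ[ℂ] KHbarAlg L n :=
  Algebra.TensorProduct.map (AlgHom.id ℂ _) (shift a)

/-- The shift operator `σ^a`: `ξ(ν) ↦ (∏ᵢ uᵢ^aᵢ) ξ(ν + ħ a)`. -/
def shiftOp (a : Fin (n + 1) → ℤ) : KHbarAlg L n →ₗ[ℂ] KHbarAlg L n :=
  LinearMap.mulLeft ℂ ((unitMonomial u a : L) ⊗ₜ 1) ∘ₗ (shiftCoef L a).toLinearMap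

theorem shiftOp_apply (a : Fin (n + 1) → ℤ) (b : KHbarAlg L n) :
    shiftOp u a b = ((unitMonomial u a : L) ⊗ₜ 1) * shiftCoef L a b := rfl

theorem shiftCoef_tmul (a : Fin (n + 1) → ℤ) (l : L) (c : KHbar n) :
    shiftCoef L a (l ⊗ₜ c) = l ⊗ₜ shift a c := by
  simp [shiftCoef]

theorem tensorDer_shiftCoef (D : Derivation ℂ L L)
    (a : Fin (n + 1) → ℤ) (b : KHbarAlg L n) :
    tensorDer n D (shiftCoef L a b) = shiftCoef L a (tensorDer n D b) := by
  induction b using TensorProduct.induction_on with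
  | zero => simp
  | add b b' h h' => simp only [map_add, h, h']
  | tmul l c => simp only [shiftCoef_tmul, tensorDer_tmul]

theorem shiftCoef_omega (D : Derivation ℂ L L)
    (a : Fin (n + 1) → ℤ) :
    shiftCoef L a (omega u D) =
      omega u D + dlog D (unitMonomial u a) ⊗ₜ hbar n := by
  rw [dlog_unitMonomial, omega, map_sum, TensorProduct.sum_tmul, ← Finset.sum_add_distrib]
  refine Finset.sum_congr rfl fun i _ => ?_
  rw [shiftCoef_tmul, shift_nu, TensorProduct.tmul_add, ← zsmul_eq_mul,
    TensorProduct.tmul_smul, ← TensorProduct.smul_tmul']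

theorem conn_shiftOp (D : Derivation ℂ L L)
    (a : Fin (n + 1) → ℤ) : conn u D * shiftOp u a = shiftOp u a * conn u D := by
  refine LinearMap.ext fun b => ?_
  simp only [Module.End.mul_apply, conn_apply, shiftOp_apply, Derivation.leibniz, map_add, map_mul,
    tensorDer_shiftCoef, shiftCoef_omega, tensorDer_tmul, shiftCoef_tmul, smul_eq_mul,
    shift_hbar]
  have h : (D (unitMonomial u a : L) ⊗ₜ[ℂ] (1 : KHbar n)) * (1 ⊗ₜ hbar n) =
      ((unitMonomial u a : L) ⊗ₜ 1) * (dlog D (unitMonomial u a) ⊗ₜ hbar n) := by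
    simp [Algebra.TensorProduct.tmul_mul_tmul, dlog]
  linear_combination shiftCoef L a b * h

theorem tensorDer_omega_sub (D E : Derivation ℂ L L) :
    tensorDer n D (omega u E) - tensorDer n E (omega u D) = omega u ⁅D, E⁆ := by
  simp only [omega, map_sum, tensorDer_tmul, ← Finset.sum_sub_distrib, dlog_bracket,
    TensorProduct.sub_tmul]

theorem tensorDer_bracket (D E : Derivation ℂ L L)
    (b : KHbarAlg L n) :
    tensorDer n ⁅D, E⁆ b = tensorDer n D (tensorDer n E b) - tensorDer n E (tensorDer n D b) := by
  induction b using TensorProduct.induction_on with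
  | zero => simp
  | add b b' h h' => simp only [map_add, h, h']; abel
  | tmul l c => simp only [tensorDer_tmul, Derivation.commutator_apply, TensorProduct.sub_tmul]

theorem tensorDer_one_tmul (D : Derivation ℂ L L)
    (c : KHbar n) : tensorDer n D (1 ⊗ₜ c) = 0 := by
  rw [tensorDer_tmul, Derivation.map_one_eq_zero, TensorProduct.zero_tmul]

theorem conn_bracket (D E : Derivation ℂ L L) :
    conn u D * conn u E = conn u E * conn u D +
      LinearMap.mulLeft ℂ (1 ⊗ₜ hbar n : KHbarAlg L n) * conn u ⁅D, E⁆ := by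
  refine LinearMap.ext fun b => ?_
  simp only [Module.End.mul_apply, LinearMap.add_apply, LinearMap.mulLeft_apply, conn_apply,
    Derivation.leibniz, map_add, smul_eq_mul, tensorDer_one_tmul, ← tensorDer_omega_sub,
    tensorDer_bracket]
  ring

theorem conn_mulLeft (D : Derivation ℂ L L) (e : KHbarAlg L n) :
    conn u D * LinearMap.mulLeft ℂ e =
      LinearMap.mulLeft ℂ e * conn u D +
        LinearMap.mulLeft ℂ ((1 ⊗ₜ hbar n) * tensorDer n D e) := by
  refine LinearMap.ext fun b => ?_
  simp only [Module.End.mul_apply, LinearMap.add_apply, LinearMap.mulLeft_apply, conn_apply,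
    Derivation.leibniz, smul_eq_mul]
  ring

theorem conn_add (D E : Derivation ℂ L L) :
    conn u (D + E) = conn u D + conn u E := by
  have ht : ∀ b : KHbarAlg L n, tensorDer n (D + E) b = tensorDer n D b + tensorDer n E b := fun b => by
    induction b using TensorProduct.induction_on with
    | zero => simp
    | add b b' h h' => simp only [map_add, h, h']; abel
    | tmul l c => simp only [tensorDer_tmul, Derivation.add_apply, TensorProduct.add_tmul]
  have ho : omega u (D + E) = omega u D + omega u E := by
    simp only [omega, dlog, Derivation.add_apply, mul_add, TensorProduct.add_tmul,
      Finset.sum_add_distrib]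
  refine LinearMap.ext fun b => ?_
  simp only [LinearMap.add_apply, conn_apply, ht, ho]
  ring

theorem conn_smul (l : L) (D : Derivation ℂ L L) :
    conn u (l • D) = LinearMap.mulLeft ℂ (l ⊗ₜ 1 : KHbarAlg L n) * conn u D := by
  have ht : ∀ b : KHbarAlg L n, tensorDer n (l • D) b = (l ⊗ₜ 1) * tensorDer n D b := fun b => by
    induction b using TensorProduct.induction_on with
    | zero => simp
    | add b b' h h' => simp only [map_add, h, h', mul_add]
    | tmul m c =>
      simp only [tensorDer_tmul, Derivation.smul_apply, smul_eq_mul,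
        Algebra.TensorProduct.tmul_mul_tmul, one_mul]
  have ho : omega u (l • D) = (l ⊗ₜ 1) * omega u D := by
    simp only [omega, dlog, Derivation.smul_apply, Finset.mul_sum, smul_eq_mul,
      Algebra.TensorProduct.tmul_mul_tmul, one_mul, mul_left_comm]
  refine LinearMap.ext fun b => ?_
  simp only [Module.End.mul_apply, LinearMap.mulLeft_apply, conn_apply, ht, ho]
  ring

theorem shiftOp_zero : shiftOp u 0 = 1 := by
  refine LinearMap.ext fun b => ?_
  simp [shiftOp_apply, shiftCoef, shift_zero, unitMonomial, ← Algebra.TensorProduct.one_def]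

theorem shiftOp_add (a b : Fin (n + 1) → ℤ) :
    shiftOp u (a + b) = shiftOp u a * shiftOp u b := by
  have hm : unitMonomial u (a + b) = unitMonomial u a * unitMonomial u b := by
    simp [unitMonomial, zpow_add, Finset.prod_mul_distrib]
  have hs : ∀ e : KHbarAlg L n,
      shiftCoef L (a + b) e = shiftCoef L a (shiftCoef L b e) := fun e => by
    induction e using TensorProduct.induction_on with
    | zero => simp
    | add e e' h h' => simp only [map_add, h, h']
    | tmul l c => simp [shiftCoef_tmul, shift_add]
  refine LinearMap.ext fun e => ?_
  have hm' : ((unitMonomial u (a + b) : L) ⊗ₜ[ℂ] (1 : KHbar n) : KHbarAlg L n) =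
      ((unitMonomial u a : L) ⊗ₜ 1) * ((unitMonomial u b : L) ⊗ₜ 1) := by
    simp [hm, Algebra.TensorProduct.tmul_mul_tmul]
  simp only [Module.End.mul_apply, shiftOp_apply, map_mul, shiftCoef_tmul, map_one, hs, hm',
    mul_assoc]

theorem shiftOp_mulLeft (a : Fin (n + 1) → ℤ) (e : KHbarAlg L n) :
    shiftOp u a * LinearMap.mulLeft ℂ e =
      LinearMap.mulLeft ℂ (shiftCoef L a e) * shiftOp u a := by
  refine LinearMap.ext fun b => ?_
  simp only [Module.End.mul_apply, LinearMap.mulLeft_apply, shiftOp_apply, map_mul]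
  ring


end Twisted

/-- The coordinate ring `O[x₁^±¹, …, xₙ^±¹]` of `Z × Tⁿ`, where `O` is the coordinate ring of the
affine variety `Z`. -/
abbrev Laurent (O : Type*) [CommRing O] (n : ℕ) : Type _ := AddMonoidAlgebra O (Fin n → ℤ)

/-- The additive map underlying the partial derivative `∂/∂xⱼ` on `O[x^±¹]`: it sends
`c x^α` to `αⱼ c x^(α - eⱼ)`. -/
def partialXHom (O : Type*) [CommRing O] {n : ℕ} (j : Fin n) : Laurent O n →+ Laurent O n where
  toFun p := p.coeff.sum fun α c => AddMonoidAlgebra.single (α - Pi.single j 1) (α j • c)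
  map_zero' := by simp
  map_add' p q := by
    rw [AddMonoidAlgebra.coeff_add]
    exact Finsupp.sum_add_index' (by simp) (by simp)

theorem partialXHom_single {O : Type*} [CommRing O] {n : ℕ} (j : Fin n) (α : Fin n → ℤ) (c : O) :
    partialXHom O j (AddMonoidAlgebra.single α c) =
      AddMonoidAlgebra.single (α - Pi.single j 1) (α j • c) := by
  change (AddMonoidAlgebra.single α c).coeff.sum (fun α c =>
    AddMonoidAlgebra.single (α - Pi.single j 1) (α j • c) : _ → _ → Laurent O n) = _
  rw [AddMonoidAlgebra.coeff_single]
  exact Finsupp.sum_single_index (by simp)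

section Geometry

variable {O : Type*} [CommRing O] [Algebra ℂ O] {n : ℕ}

/-- A vector field `θ` on `Z`, acting on `O[x^±¹]` through the coefficients. -/
def coeffDer (n : ℕ) (θ : Derivation ℂ O O) : Derivation ℂ (Laurent O n) (Laurent O n) :=
  Derivation.mk'
    { toFun := AddMonoidAlgebra.map (θ : O →+ O)
      map_add' := AddMonoidAlgebra.map_add _
      map_smul' := fun c p => by ext; simp }
    (by
      intro p q
      simp only [LinearMap.coe_mk, AddHom.coe_mk]
      induction p using AddMonoidAlgebra.induction_linear with
      | zero => simp
      | add p p' hp hp' =>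
        simp only [add_mul, AddMonoidAlgebra.map_add, hp, hp', smul_eq_mul, mul_add]; ring
      | single α c =>
        induction q using AddMonoidAlgebra.induction_linear with
        | zero => simp
        | add q q' hq hq' =>
          simp only [mul_add, AddMonoidAlgebra.map_add, hq, hq', smul_eq_mul, add_mul]; ring
        | single β d =>
          simp only [AddMonoidAlgebra.single_mul_single, AddMonoidAlgebra.map_single, smul_eq_mul,
            AddMonoidHom.coe_coe, Derivation.leibniz, AddMonoidAlgebra.single_add]
          rw [add_comm β α])

theorem coeffDer_single (θ : Derivation ℂ O O) (α : Fin n → ℤ) (c : O) :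
    coeffDer n θ (AddMonoidAlgebra.single α c) = AddMonoidAlgebra.single α (θ c) :=
  AddMonoidAlgebra.map_single _ _ _

/-- The partial derivative `∂/∂xⱼ` on `O[x^±¹]`. -/
def partialX (O : Type*) [CommRing O] [Algebra ℂ O] (j : Fin n) :
    Derivation ℂ (Laurent O n) (Laurent O n) :=
  Derivation.mk'
    { toFun := partialXHom O j
      map_add' := map_add _
      map_smul' := fun c p => by
        induction p using AddMonoidAlgebra.induction_linear with
        | zero => simp
        | add p p' hp hp' => simp only [smul_add, map_add, hp, hp']
        | single α d =>
          rw [AddMonoidAlgebra.smul_single, partialXHom_single, partialXHom_single,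
            RingHom.id_apply, AddMonoidAlgebra.smul_single, smul_comm] }
    (by
      intro p q
      simp only [LinearMap.coe_mk, AddHom.coe_mk]
      induction p using AddMonoidAlgebra.induction_linear with
      | zero => simp
      | add p p' hp hp' =>
        simp only [add_mul, map_add, hp, hp', smul_eq_mul, mul_add]; ring
      | single α c =>
        induction q using AddMonoidAlgebra.induction_linear with
        | zero => simp
        | add q q' hq hq' =>
          simp only [mul_add, map_add, hq, hq', smul_eq_mul, add_mul]; ring
        | single β d =>
          rw [AddMonoidAlgebra.single_mul_single, partialXHom_single, partialXHom_single,
            partialXHom_single, smul_eq_mul, smul_eq_mul, AddMonoidAlgebra.single_mul_single,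
            AddMonoidAlgebra.single_mul_single,
            show α + (β - Pi.single j 1) = α + β - Pi.single j 1 by abel,
            show β + (α - Pi.single j 1) = α + β - Pi.single j 1 by abel,
            ← AddMonoidAlgebra.single_add]
          congr 1
          simp only [zsmul_eq_mul, Pi.add_apply, Int.cast_add]
          ring)

theorem partialX_single (j : Fin n) (α : Fin n → ℤ) (c : O) :
    partialX O j (AddMonoidAlgebra.single α c) =
      AddMonoidAlgebra.single (α - Pi.single j 1) (α j • c) :=
  partialXHom_single j α c

/-- The ring `O[x^±¹][1/f]` of regular functions on the complement of `f = 0` in `Z × Tⁿ`, which is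
isomorphic to the hypersurface `1 = y f(x; z)` in `Z × Tⁿ × ℂ*`. -/
abbrev Compl (f : Laurent O n) : Type _ := Localization.Away f

/-- The unique extension of a derivation of `O[x^±¹]` to `O[x^±¹][1/f]`. -/
def extendDer (f : Laurent O n) (D : Derivation ℂ (Laurent O n) (Laurent O n)) :
    Derivation ℂ (Compl f) (Compl f) :=
  localizeDer (Submonoid.powers f) D

theorem extendDer_algebraMap (f : Laurent O n) (D : Derivation ℂ (Laurent O n) (Laurent O n))
    (p : Laurent O n) : extendDer f D (algebraMap _ _ p) = algebraMap _ _ (D p) :=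
  localizeDer_algebraMap _ D p

/-- Derivations of `O[x^±¹][1/f]` are determined by their values on Laurent monomials. -/
theorem der_ext {f : Laurent O n} {D E : Derivation ℂ (Compl f) (Compl f)}
    (h : ∀ α c, D (algebraMap (Laurent O n) _ (AddMonoidAlgebra.single α c)) =
      E (algebraMap (Laurent O n) _ (AddMonoidAlgebra.single α c))) : D = E := by
  have h' : ∀ p : Laurent O n, D (algebraMap _ _ p) = E (algebraMap _ _ p) := by
    intro p
    induction p using AddMonoidAlgebra.induction_linear with
    | zero => simp
    | add p q hp hq => simp only [map_add, hp, hq]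
    | single α c => exact h α c
  ext l
  obtain ⟨⟨p, s⟩, hs⟩ := IsLocalization.surj (Submonoid.powers f) l
  have hu : IsUnit (algebraMap (Laurent O n) (Compl f) s) := IsLocalization.map_units _ s
  have h1 := congrArg D hs
  have h2 := congrArg E hs
  simp only [Derivation.leibniz, h', smul_eq_mul] at h1 h2
  exact hu.mul_left_cancel (by linear_combination h1 - h2)

/-- The vector field `θ` on `Z`, acting on `O[x^±¹][1/f]`. -/
def liftVF (f : Laurent O n) (θ : Derivation ℂ O O) : Derivation ℂ (Compl f) (Compl f) :=
  extendDer f (coeffDer n θ)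

/-- The partial derivative `∂/∂xⱼ`, acting on `O[x^±¹][1/f]`. -/
def liftPartial (f : Laurent O n) (j : Fin n) : Derivation ℂ (Compl f) (Compl f) :=
  extendDer f (partialX O j)

/-- `f` as a unit of `O[x^±¹][1/f]`. -/
def fUnit (f : Laurent O n) : (Compl f)ˣ :=
  (IsLocalization.Away.algebraMap_isUnit (S := Compl f) f).unit

/-- The coordinate `xⱼ` as a unit of `O[x^±¹][1/f]`. -/
def xUnit (f : Laurent O n) (j : Fin n) : (Compl f)ˣ where
  val := algebraMap (Laurent O n) _ (AddMonoidAlgebra.single (Pi.single j 1) 1)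
  inv := algebraMap (Laurent O n) _ (AddMonoidAlgebra.single (-Pi.single j 1) 1)
  val_inv := by
    rw [← map_mul, AddMonoidAlgebra.single_mul_single, add_neg_cancel, one_mul,
      ← AddMonoidAlgebra.one_def, map_one]
  inv_val := by
    rw [← map_mul, AddMonoidAlgebra.single_mul_single, neg_add_cancel, one_mul,
      ← AddMonoidAlgebra.one_def, map_one]

/-- The units `u₀ = 1/f`, `u₁ = x₁`, …, `uₙ = xₙ` of `O[x^±¹][1/f]`, so that
`f^(-ν₀) x₁^ν₁ ⋯ xₙ^νₙ = ∏ᵢ uᵢ^νᵢ`. -/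
def eulerUnit (f : Laurent O n) : Fin (n + 1) → (Compl f)ˣ :=
  Fin.cons (fUnit f)⁻¹ (xUnit f)
theorem liftVF_add (f : Laurent O n) (θ η : Derivation ℂ O O) :
    liftVF f (θ + η) = liftVF f θ + liftVF f η := by
  refine der_ext fun α c => ?_
  simp [liftVF, extendDer_algebraMap, coeffDer_single, AddMonoidAlgebra.single_add]

theorem liftVF_smul (f : Laurent O n) (g : O) (θ : Derivation ℂ O O) :
    liftVF f (g • θ) = algebraMap O (Compl f) g • liftVF f θ := by
  refine der_ext fun α c => ?_
  rw [IsScalarTower.algebraMap_apply O (Laurent O n) (Compl f), Derivation.smul_apply, liftVF,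
    liftVF, extendDer_algebraMap, extendDer_algebraMap, coeffDer_single, coeffDer_single,
    smul_eq_mul, ← map_mul]
  congr 1
  refine Eq.trans ?_ (AddMonoidAlgebra.single_mul_single 0 α g (θ c)).symm
  simp

theorem liftVF_bracket (f : Laurent O n) (θ η : Derivation ℂ O O) :
    liftVF f ⁅θ, η⁆ = ⁅liftVF f θ, liftVF f η⁆ := by
  refine der_ext fun α c => ?_
  simp [liftVF, extendDer_algebraMap, coeffDer_single, Derivation.commutator_apply,
    AddMonoidAlgebra.single_sub]

theorem liftPartial_liftVF (f : Laurent O n) (j : Fin n) (θ : Derivation ℂ O O) :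
    ⁅liftPartial f j, liftVF f θ⁆ = 0 := by
  refine der_ext fun α c => ?_
  simp [liftVF, liftPartial, extendDer_algebraMap, coeffDer_single, partialX_single,
    Derivation.commutator_apply]

theorem liftPartial_liftPartial (f : Laurent O n) (i j : Fin n) :
    ⁅liftPartial f i, liftPartial f j⁆ = 0 := by
  refine der_ext fun α c => ?_
  rw [Derivation.commutator_apply, Derivation.zero_apply, liftPartial, liftPartial]
  simp only [extendDer_algebraMap, partialX_single]
  rw [← map_sub, sub_sub, sub_sub, 
    add_comm (Pi.single j (1 : ℤ) : Fin n → ℤ) (Pi.single i 1)]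
  by_cases h : i = j
  · subst h; simp
  · simp [h, Ne.symm h, mul_left_comm]

theorem liftVF_algebraMap (f : Laurent O n) (θ : Derivation ℂ O O) (g : O) :
    liftVF f θ (algebraMap O (Compl f) g) = algebraMap O (Compl f) (θ g) := by
  rw [IsScalarTower.algebraMap_apply O (Laurent O n) (Compl f),
    IsScalarTower.algebraMap_apply O (Laurent O n) (Compl f)]
  exact (extendDer_algebraMap f _ _).trans (congrArg _ (coeffDer_single θ 0 g))

theorem liftPartial_algebraMap (f : Laurent O n) (j : Fin n) (g : O) :
    liftPartial f j (algebraMap O (Compl f) g) = 0 := by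
  rw [IsScalarTower.algebraMap_apply O (Laurent O n) (Compl f)]
  refine (extendDer_algebraMap f _ _).trans ?_
  refine (congrArg _ (partialX_single j 0 g)).trans ?_
  simp

theorem liftVF_xUnit (f : Laurent O n) (θ : Derivation ℂ O O) (j : Fin n) :
    liftVF f θ (xUnit f j : Compl f) = 0 := by
  refine (extendDer_algebraMap f _ _).trans ?_
  rw [coeffDer_single]
  simp

end Geometry

/-! ### The ring of `ħ`-differential-difference operators -/

/-- Generators of the ring of `ħ`-differential-difference operators on `Z = Spec O`: scalars in
`K⟦ħ⟧`, functions on `Z`, the operators `θ^ħ = ħ θ` for vector fields `θ` on `Z`, and the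
difference operators `σ^a = σ_{ν₀}^a₀ ⋯ σ_{νₙ}^aₙ`. -/
inductive DDGen (O : Type*) [CommRing O] [Algebra ℂ O] (n : ℕ) where
  | coef (c : KHbar n)
  | func (g : O)
  | vf (θ : Derivation ℂ O O)
  | sigma (a : Fin (n + 1) → ℤ)

section Relations

variable {O : Type*} [CommRing O] [Algebra ℂ O] {n : ℕ}

/-- The free `ℂ`-algebra on the generators. -/
abbrev DDFree (O : Type*) [CommRing O] [Algebra ℂ O] (n : ℕ) : Type _ :=
  FreeAlgebra ℂ (DDGen O n)

local notation "κ" c => (FreeAlgebra.ι ℂ (DDGen.coef c) : DDFree _ _)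
local notation "φ" g => (FreeAlgebra.ι ℂ (DDGen.func g) : DDFree _ _)
local notation "δ" θ => (FreeAlgebra.ι ℂ (DDGen.vf θ) : DDFree _ _)
local notation "σ" a => (FreeAlgebra.ι ℂ (DDGen.sigma a) : DDFree _ _)

/-- The relations: `K⟦ħ⟧` and `O` are commuting `ℂ`-subalgebras, `θ ↦ θ^ħ` is `O`-linear,
`[θ^ħ, g] = ħ θ(g)`, `[θ^ħ, η^ħ] = ħ [θ, η]^ħ`, the `σ^a` form a group isomorphic to `ℤ^(n+1)`
commuting with functions and vector fields on `Z`, and `σ^a c(ν) = c(ν + ħ a) σ^a` for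
`c ∈ K⟦ħ⟧` (in particular `[σ_{νᵢ}, νⱼ] = δᵢⱼ ħ σ_{νᵢ}`). -/
inductive DDRel (O : Type*) [CommRing O] [Algebra ℂ O] (n : ℕ) : DDFree O n → DDFree O n → Prop
  | coef_add (c d : KHbar n) : DDRel O n (κ (c + d)) ((κ c) + κ d)
  | coef_mul (c d : KHbar n) : DDRel O n (κ (c * d)) ((κ c) * κ d)
  | coef_algebraMap (r : ℂ) : DDRel O n (κ (algebraMap ℂ (KHbar n) r)) (algebraMap ℂ _ r)
  | func_add (g h : O) : DDRel O n (φ (g + h)) ((φ g) + φ h)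
  | func_mul (g h : O) : DDRel O n (φ (g * h)) ((φ g) * φ h)
  | func_algebraMap (r : ℂ) : DDRel O n (φ (algebraMap ℂ O r)) (algebraMap ℂ _ r)
  | coef_func (c : KHbar n) (g : O) : DDRel O n ((κ c) * φ g) ((φ g) * κ c)
  | vf_add (θ η : Derivation ℂ O O) : DDRel O n (δ (θ + η)) ((δ θ) + δ η)
  | vf_smul (g : O) (θ : Derivation ℂ O O) : DDRel O n (δ (g • θ)) ((φ g) * δ θ)
  | vf_coef (θ : Derivation ℂ O O) (c : KHbar n) : DDRel O n ((δ θ) * κ c) ((κ c) * δ θ)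
  | vf_func (θ : Derivation ℂ O O) (g : O) :
      DDRel O n ((δ θ) * φ g) ((φ g) * (δ θ) + (κ (hbar n)) * φ (θ g))
  | vf_vf (θ η : Derivation ℂ O O) :
      DDRel O n ((δ θ) * δ η) ((δ η) * (δ θ) + (κ (hbar n)) * δ ⁅θ, η⁆)
  | sigma_zero : DDRel O n (σ 0) 1
  | sigma_add (a b : Fin (n + 1) → ℤ) : DDRel O n (σ (a + b)) ((σ a) * σ b)
  | sigma_coef (a : Fin (n + 1) → ℤ) (c : KHbar n) :
      DDRel O n ((σ a) * κ c) ((κ (shift a c)) * σ a)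
  | sigma_func (a : Fin (n + 1) → ℤ) (g : O) : DDRel O n ((σ a) * φ g) ((φ g) * σ a)
  | sigma_vf (a : Fin (n + 1) → ℤ) (θ : Derivation ℂ O O) :
      DDRel O n ((σ a) * δ θ) ((δ θ) * σ a)

/-- The ring `DD_⟦ħ⟧` of `ħ`-differential-difference operators on `Z = Spec O`. -/
def DD (O : Type*) [CommRing O] [Algebra ℂ O] (n : ℕ) : Type _ := RingQuot (DDRel O n)

instance : Ring (DD O n) := inferInstanceAs (Ring (RingQuot (DDRel O n)))

instance : Algebra ℂ (DD O n) := inferInstanceAs (Algebra ℂ (RingQuot (DDRel O n)))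

namespace DD

variable (O n) in
/-- The quotient map from the free algebra. -/
def mk : DDFree O n →ₐ[ℂ] DD O n := RingQuot.mkAlgHom ℂ (DDRel O n)

theorem mk_surjective : Function.Surjective (mk O n) :=
  RingQuot.mkAlgHom_surjective ℂ (DDRel O n)

theorem mk_rel {x y : DDFree O n} (h : DDRel O n x y) : mk O n x = mk O n y :=
  RingQuot.mkAlgHom_rel ℂ h

/-- The universal property of `DD_⟦ħ⟧`. -/
def lift {A : Type*} [Ring A] [Algebra ℂ A] (F : DDFree O n →ₐ[ℂ] A)
    (hF : ∀ x y, DDRel O n x y → F x = F y) : DD O n →ₐ[ℂ] A :=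
  RingQuot.liftAlgHom ℂ ⟨F, fun {x y} h => hF x y h⟩

theorem lift_mk {A : Type*} [Ring A] [Algebra ℂ A] (F : DDFree O n →ₐ[ℂ] A)
    (hF : ∀ x y, DDRel O n x y → F x = F y) (x : DDFree O n) : lift F hF (mk O n x) = F x :=
  RingQuot.liftAlgHom_mkAlgHom_apply ℂ F _ x

variable (O n) in
/-- The image of a generator in `DD_⟦ħ⟧`. -/
def gen (g : DDGen O n) : DD O n := mk O n (FreeAlgebra.ι ℂ g)

/-- A scalar `c ∈ K⟦ħ⟧` as an operator. -/
def coef (O : Type*) [CommRing O] [Algebra ℂ O] {n : ℕ} (c : KHbar n) : DD O n :=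
  gen O n (.coef c)

/-- A function on `Z` as an operator. -/
def func (n : ℕ) (g : O) : DD O n := gen O n (.func g)

/-- The operator `θ^ħ = ħ θ` attached to a vector field `θ` on `Z`. -/
def vf (n : ℕ) (θ : Derivation ℂ O O) : DD O n := gen O n (.vf θ)

/-- The difference operator `σ^a`. -/
def sigma (O : Type*) [CommRing O] [Algebra ℂ O] {n : ℕ} (a : Fin (n + 1) → ℤ) : DD O n :=
  gen O n (.sigma a)

/-- The difference operator `σ_{νᵢ}`. -/
def sigmaAt (O : Type*) [CommRing O] [Algebra ℂ O] {n : ℕ} (i : Fin (n + 1)) : DD O n :=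
  sigma O (Pi.single i 1)

/-- For `p = ∑ c_α(z) x^α ∈ O[x^±¹]`, the operator
`p(σ_ν; z) = ∑ c_α(z) σ_{ν₁}^α₁ ⋯ σ_{νₙ}^αₙ`. -/
def evalSigma (p : Laurent O n) : DD O n :=
  p.coeff.sum fun α c => func n c * sigma O (Fin.cons 0 α)

/-- The left ideal `J_⟦ħ⟧` generated by `1 - σ_s f(σ_ν; z)`, by
`νⱼ - s σ_s σ_{νⱼ} (∂f/∂xⱼ)(σ_ν; z)` for `j = 1, …, n`, and by `θ^ħ + s σ_s (θf)(σ_ν; z)` for all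
vector fields `θ` on `Z`, where `s = ν₀`. -/
def J (f : Laurent O n) : Submodule (DD O n) (DD O n) :=
  Submodule.span (DD O n)
    ({1 - sigmaAt O 0 * evalSigma f} ∪
      (Set.range fun j : Fin n => coef O (nu j.succ) -
        coef O (nu 0) * sigmaAt O 0 * sigmaAt O j.succ * evalSigma (partialX O j f)) ∪
      (Set.range fun θ : Derivation ℂ O O => vf n θ +
        coef O (nu 0) * sigmaAt O 0 * evalSigma (coeffDer n θ f)))

/-- The `ħ`-deformed hypergeometric module `M^hyp_⟦ħ⟧ = DD_⟦ħ⟧ / J_⟦ħ⟧`. -/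
abbrev MHyp (f : Laurent O n) : Type _ := DD O n ⧸ J f

end DD

/-! ### The relative `ħ`-twisted de Rham complex -/

/-- The ring of regular functions on the base change to `K⟦ħ⟧` of the complement of `f = 0` in
`Z × Tⁿ`, that is, `O[x^±¹][1/f] ⊗ K⟦ħ⟧`. -/
def FunRing (f : Laurent O n) : Type _ := KHbarAlg (Compl f) n

instance (f : Laurent O n) : CommRing (FunRing f) := inferInstanceAs (CommRing (KHbarAlg (Compl f) n))

/-- The function `l ⊗ c`. -/
def FunRing.tmul {f : Laurent O n} (l : Compl f) (c : KHbar n) : FunRing f :=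
  (l ⊗ₜ c : KHbarAlg (Compl f) n)

/-- Action of the generators of `DD_⟦ħ⟧` on functions: scalars and functions on `Z` act by
multiplication, `θ^ħ` acts by `b ↦ ħ θ(b) - ν₀ (θ(f)/f) b`, and `σ^a` acts by
`b(ν) ↦ f^(-a₀) x₁^a₁ ⋯ xₙ^aₙ b(ν + ħ a)`. -/
def genAction (f : Laurent O n) : DDGen O n → Module.End ℂ (KHbarAlg (Compl f) n)
  | .coef c => LinearMap.mulLeft ℂ (1 ⊗ₜ c)
  | .func g => LinearMap.mulLeft ℂ (algebraMap O (Compl f) g ⊗ₜ 1)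
  | .vf θ => conn (eulerUnit f) (liftVF f θ)
  | .sigma a => shiftOp (eulerUnit f) a

theorem genAction_rel (f : Laurent O n) {x y : DDFree O n} (h : DDRel O n x y) :
    FreeAlgebra.lift ℂ (genAction f) x = FreeAlgebra.lift ℂ (genAction f) y := by
  have hml : ∀ a b : KHbarAlg (Compl f) n,
      LinearMap.mulLeft ℂ (a * b) = LinearMap.mulLeft ℂ a * LinearMap.mulLeft ℂ b :=
    fun a b => LinearMap.ext fun c => mul_assoc a b c
  have hma : ∀ a b : KHbarAlg (Compl f) n,
      LinearMap.mulLeft ℂ (a + b) = LinearMap.mulLeft ℂ a + LinearMap.mulLeft ℂ b :=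
    fun a b => LinearMap.ext fun c => add_mul a b c
  have hmc : ∀ a b : KHbarAlg (Compl f) n,
      LinearMap.mulLeft ℂ a * LinearMap.mulLeft ℂ b =
        LinearMap.mulLeft ℂ b * LinearMap.mulLeft ℂ a :=
    fun a b => by rw [← hml, ← hml, mul_comm]
  have halg : ∀ r : ℂ, LinearMap.mulLeft ℂ (algebraMap ℂ (KHbarAlg (Compl f) n) r) =
      algebraMap ℂ (Module.End ℂ (KHbarAlg (Compl f) n)) r :=
    fun r => LinearMap.ext fun c => (Algebra.smul_def r c).symm
  cases h with
  | coef_add c d =>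
    simp only [FreeAlgebra.lift_ι_apply, map_add, genAction, TensorProduct.tmul_add, hma]
  | coef_mul c d =>
    simp only [FreeAlgebra.lift_ι_apply, map_mul, genAction, ← hml,
      Algebra.TensorProduct.tmul_mul_tmul, one_mul]
  | coef_algebraMap r =>
    rw [FreeAlgebra.lift_ι_apply, AlgHom.commutes, ← halg, genAction,
      Algebra.TensorProduct.algebraMap_apply']
  | func_add g h =>
    simp only [FreeAlgebra.lift_ι_apply, map_add, genAction, TensorProduct.add_tmul, hma]
  | func_mul g h =>
    simp only [FreeAlgebra.lift_ι_apply, map_mul, genAction, ← hml,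
      Algebra.TensorProduct.tmul_mul_tmul, one_mul]
  | func_algebraMap r =>
    rw [FreeAlgebra.lift_ι_apply, AlgHom.commutes, ← halg, genAction,
      Algebra.TensorProduct.algebraMap_apply, ← IsScalarTower.algebraMap_apply]
  | coef_func c g =>
    simp only [FreeAlgebra.lift_ι_apply, map_mul, genAction, hmc]
  | vf_add θ η =>
    simp only [FreeAlgebra.lift_ι_apply, map_add, genAction, liftVF_add, conn_add]
  | vf_smul g θ =>
    simp only [FreeAlgebra.lift_ι_apply, map_mul, genAction, liftVF_smul, conn_smul]
  | vf_coef θ c =>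
    simp only [FreeAlgebra.lift_ι_apply, map_mul, genAction]
    rw [conn_mulLeft, tensorDer_one_tmul, mul_zero, LinearMap.mulLeft_zero_eq_zero, add_zero]
  | vf_func θ g =>
    simp only [FreeAlgebra.lift_ι_apply, map_mul, map_add, genAction]
    rw [conn_mulLeft, tensorDer_tmul, liftVF_algebraMap, hml]
  | vf_vf θ η =>
    simp only [FreeAlgebra.lift_ι_apply, map_mul, map_add, genAction, liftVF_bracket]
    rw [conn_bracket]
  | sigma_zero =>
    simp only [FreeAlgebra.lift_ι_apply, map_one, genAction, shiftOp_zero]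
  | sigma_add a b =>
    simp only [FreeAlgebra.lift_ι_apply, map_mul, genAction, shiftOp_add]
  | sigma_coef a c =>
    simp only [FreeAlgebra.lift_ι_apply, map_mul, genAction]
    rw [shiftOp_mulLeft, shiftCoef_tmul]
  | sigma_func a g =>
    simp only [FreeAlgebra.lift_ι_apply, map_mul, genAction]
    rw [shiftOp_mulLeft, shiftCoef_tmul, map_one]
  | sigma_vf a θ =>
    simp only [FreeAlgebra.lift_ι_apply, map_mul, genAction, conn_shiftOp]

/-- The action of `DD_⟦ħ⟧` on `O[x^±¹][1/f] ⊗ K⟦ħ⟧`. -/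
def action (f : Laurent O n) : DD O n →ₐ[ℂ] Module.End ℂ (KHbarAlg (Compl f) n) :=
  DD.lift (FreeAlgebra.lift ℂ (genAction f)) fun _ _ h => genAction_rel f h

instance (f : Laurent O n) : Module (DD O n) (FunRing f) where
  smul P b := action f P b
  one_smul b := LinearMap.congr_fun (map_one (action f)) b
  mul_smul P Q b := LinearMap.congr_fun (map_mul (action f) P Q) b
  smul_zero P := map_zero (action f P)
  smul_add P b c := map_add (action f P) b c
  add_smul P Q b := LinearMap.congr_fun (map_add (action f) P Q) b
  zero_smul b := LinearMap.congr_fun (map_zero (action f)) b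

theorem smul_def (f : Laurent O n) (P : DD O n) (b : FunRing f) : P • b = action f P b := rfl

theorem action_gen (f : Laurent O n) (g : DDGen O n) :
    action f (DD.gen O n g) = genAction f g := by
  rw [action, DD.gen, DD.lift_mk, FreeAlgebra.lift_ι_apply]

theorem action_commute (f : Laurent O n) (j : Fin n) (P : DD O n) :
    conn (eulerUnit f) (liftPartial f j) * action f P =
      action f P * conn (eulerUnit f) (liftPartial f j) := by
  obtain ⟨x, rfl⟩ := DD.mk_surjective P
  induction x using FreeAlgebra.induction with
  | grade0 r => simp only [AlgHom.commutes]; exact (Algebra.commutes r _).symm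
  | add x y hx hy => simp only [map_add, mul_add, add_mul, hx, hy]
  | mul x y hx hy => simp only [map_mul]; rw [← mul_assoc, hx, mul_assoc, hy, mul_assoc]
  | grade1 g =>
    change conn (eulerUnit f) (liftPartial f j) * action f (DD.gen O n g) =
      action f (DD.gen O n g) * conn (eulerUnit f) (liftPartial f j)
    rw [action_gen]
    cases g with
    | coef c =>
      refine (conn_mulLeft _ _ _).trans ?_
      rw [tensorDer_one_tmul, mul_zero, LinearMap.mulLeft_zero_eq_zero, add_zero]
      rfl
    | func g =>
      refine (conn_mulLeft _ _ _).trans ?_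
      rw [tensorDer_tmul, liftPartial_algebraMap, TensorProduct.zero_tmul, mul_zero,
        LinearMap.mulLeft_zero_eq_zero, add_zero]
      rfl
    | vf θ =>
      have h := conn_bracket (eulerUnit f) (liftPartial f j) (liftVF f θ)
      have h0 : conn (eulerUnit f) (0 : Derivation ℂ (Compl f) (Compl f)) = 0 := by
        have := conn_smul (eulerUnit f) 0 (0 : Derivation ℂ (Compl f) (Compl f))
        rwa [zero_smul, TensorProduct.zero_tmul, LinearMap.mulLeft_zero_eq_zero, zero_mul] at this
      rw [liftPartial_liftVF, h0, mul_zero, add_zero] at h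
      exact h
    | sigma a => exact conn_shiftOp _ _ _

/-- The component `∇ⱼ = ħ ∂/∂xⱼ + νⱼ/xⱼ - ν₀ (∂f/∂xⱼ)/f` of the twisted differential. -/
def nablaX (f : Laurent O n) (j : Fin n) : FunRing f →ₗ[DD O n] FunRing f where
  toFun := conn (eulerUnit f) (liftPartial f j)
  map_add' := map_add (conn (eulerUnit f) (liftPartial f j))
  map_smul' P b := LinearMap.congr_fun (action_commute f j P) b

theorem nablaX_comm (f : Laurent O n) (i j : Fin n) (b : FunRing f) :
    nablaX f i (nablaX f j b) = nablaX f j (nablaX f i b) := by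
  have h := conn_bracket (eulerUnit f) (liftPartial f i) (liftPartial f j)
  have h0 : conn (eulerUnit f) (0 : Derivation ℂ (Compl f) (Compl f)) = 0 := by
    have := conn_smul (eulerUnit f) 0 (0 : Derivation ℂ (Compl f) (Compl f))
    rwa [zero_smul, TensorProduct.zero_tmul, LinearMap.mulLeft_zero_eq_zero, zero_mul] at this
  rw [liftPartial_liftPartial, h0, mul_zero, add_zero] at h
  exact LinearMap.congr_fun h b

/-- Relative `k`-forms `∑_I b_I dx_I`, where `I` runs over the `k`-element subsets of `{1, …, n}`
and `dx_I = dx_{i₁} ∧ ⋯ ∧ dx_{iₖ}` for `I = {i₁ < ⋯ < iₖ}`. The ring `DD_⟦ħ⟧` acts on the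
coefficients. -/
abbrev Forms (f : Laurent O n) (k : ℕ) : Type _ :=
  {I : Finset (Fin n) // I.card = k} → FunRing f

/-- The index set `J ∖ {j}`. -/
def eraseIdx {k : ℕ} (J : {I : Finset (Fin n) // I.card = k + 1}) (j : {j // j ∈ J.1}) :
    {I : Finset (Fin n) // I.card = k} :=
  ⟨J.1.erase j.1, by rw [Finset.card_erase_of_mem j.2, J.2, Nat.add_sub_cancel]⟩

/-- The twisted differential `∇ = ħ d_x + ω ∧`, `ω = -ν₀ d_x f / f + ∑ⱼ νⱼ dxⱼ / xⱼ`: the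
coefficient of `dx_J` in `∇(∑_I b_I dx_I)` is `∑_{j ∈ J} (-1)^#{i ∈ J | i < j} ∇ⱼ b_{J ∖ {j}}`. -/
def nabla (f : Laurent O n) (k : ℕ) : Forms f k →ₗ[DD O n] Forms f (k + 1) :=
  LinearMap.pi fun J => ∑ j : {j // j ∈ J.1},
    (-1 : ℤ) ^ (J.1.filter (· < j.1)).card • (nablaX f j.1 ∘ₗ LinearMap.proj (eraseIdx J j))

/-- The coboundaries in degree `k`. -/
def coboundaries (f : Laurent O n) : (k : ℕ) → Submodule (DD O n) (Forms f k)
  | 0 => ⊥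
  | k + 1 => LinearMap.range (nabla f k)

/-- The cohomology `Hᵏ((X/Z)_{K⟦ħ⟧}, ω)` of the `ħ`-twisted relative de Rham complex. -/
abbrev Cohomology (f : Laurent O n) (k : ℕ) : Type _ :=
  LinearMap.ker (nabla f k) ⧸ (coboundaries f k).submoduleOf (LinearMap.ker (nabla f k))

/-- The top form `dx₁/x₁ ∧ ⋯ ∧ dxₙ/xₙ`. -/
def dlogForm (f : Laurent O n) : Forms f n := fun I =>
  FunRing.tmul (∏ i ∈ I.1, (((xUnit f i)⁻¹ : (Compl f)ˣ) : Compl f)) 1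

theorem nabla_top (f : Laurent O n) (ξ : Forms f n) : nabla f n ξ = 0 := by
  funext J
  have := Finset.card_le_univ J.1
  rw [J.2, Fintype.card_fin] at this
  omega

/-- The class of `dx₁/x₁ ∧ ⋯ ∧ dxₙ/xₙ` in the top cohomology. -/
def dlogClass (f : Laurent O n) : Cohomology f n :=
  Submodule.Quotient.mk ⟨dlogForm f, nabla_top f _⟩

end Relations

end HbarHyp

end

noncomputable section

namespace HbarHyp

set_option linter.unusedSectionVars false

/-! ### Relations in `DD`, and difference operators with coefficients in `O` -/

section Evaluation

variable {O : Type*} [CommRing O] [Algebra ℂ O] {n : ℕ}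

namespace DD

/-! Both sides are cyclic modules over `DD`, generated by `[1]` and by the class of the logarithmic
form. It therefore suffices to construct `DD`-linear maps in both directions that exchange these
generators; they are then automatically inverse to each other.

In top degree a form has a single coefficient, an element of `FunRing f`, and the coboundaries
become the functions `∑ⱼ ∇ⱼ bⱼ` (`coboundaries_top`). The form `dx₁/x₁ ∧ ⋯ ∧ dxₙ/xₙ` has coefficient
`1/(x₁⋯xₙ)`.

From the hypergeometric module to cohomology, the generators of `J` must kill the class. On the
function `1/(x₁⋯xₙ)` the first generator acts as `1 - f⁻¹f = 0`, the generators attached to vector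
fields also act as zero, and the generator with `νⱼ` gives `∇ⱼ(xⱼ/(x₁⋯xₙ))`, which is exact
(`nablaX_xUnit_mul_dlogCoef`).

In the other direction, `O[x^±¹][1/f]` is the commutative ring of Laurent polynomials over `O` in
`σ_{ν₀}, …, σ_{νₙ}` modulo `σ_{ν₀} f(σ_ν) = 1` (`complEval_surjective`,
`exists_of_complEval_eq_zero`). Since this relation kills `[1]`, a function represented by `P(σ)`
can be sent to `P(σ) σ_{ν₁}⋯σ_{νₙ} [1]`, and the map extends to `K⟦ħ⟧`-coefficients. Compatibility
with `K⟦ħ⟧`, `O` and the `σ^a` follows from the commutation rules. For `θ^ħ` one moves `θ^ħ` to the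
right until it meets the generator, where both modules satisfy the same relation (`funToHypHom_vf`).

It remains to see that this map kills the image of each `∇ⱼ`. Since `∇ⱼ` is `DD`-linear and any
single Laurent monomial generates `FunRing f` over `DD`, it is enough to test `xⱼ/(x₁⋯xₙ)`, where
the vanishing is exactly the relation for `νⱼ` (`funToHyp_comp_nablaX`). -/

theorem coef_add (c d : KHbar n) : coef O (c + d) = coef O c + coef O d :=
  (mk_rel (.coef_add c d)).trans (map_add _ _ _)

theorem coef_mul (c d : KHbar n) : coef O (c * d) = coef O c * coef O d :=
  (mk_rel (.coef_mul c d)).trans (map_mul _ _ _)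

theorem coef_algebraMap (r : ℂ) : coef O (algebraMap ℂ (KHbar n) r) = algebraMap ℂ (DD O n) r :=
  (mk_rel (.coef_algebraMap r)).trans (AlgHom.commutes _ _)

theorem coef_one : coef O (1 : KHbar n) = 1 := by
  simpa using coef_algebraMap (O := O) (n := n) 1

theorem func_add (g h : O) : func n (g + h) = func n g + func n h :=
  (mk_rel (.func_add g h)).trans (map_add _ _ _)

theorem func_mul (g h : O) : func n (g * h) = func n g * func n h :=
  (mk_rel (.func_mul g h)).trans (map_mul _ _ _)

theorem func_algebraMap (r : ℂ) : func n (algebraMap ℂ O r) = algebraMap ℂ (DD O n) r :=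
  (mk_rel (.func_algebraMap r)).trans (AlgHom.commutes _ _)

theorem coef_func (c : KHbar n) (g : O) : coef O c * func n g = func n g * coef O c :=
  (map_mul _ _ _).symm.trans ((mk_rel (.coef_func c g)).trans (map_mul _ _ _))

theorem vf_coef (θ : Derivation ℂ O O) (c : KHbar n) :
    vf n θ * coef O c = coef O c * vf n θ :=
  (map_mul _ _ _).symm.trans ((mk_rel (.vf_coef θ c)).trans (map_mul _ _ _))

theorem vf_func (θ : Derivation ℂ O O) (g : O) :
    vf n θ * func n g = func n g * vf n θ + coef O (hbar n) * func n (θ g) :=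
  (map_mul _ _ _).symm.trans ((mk_rel (.vf_func θ g)).trans (by simp only [map_add, map_mul]; rfl))

theorem sigma_zero : sigma O (0 : Fin (n + 1) → ℤ) = 1 :=
  (mk_rel .sigma_zero).trans (map_one _)

theorem sigma_add (a b : Fin (n + 1) → ℤ) : sigma O (a + b) = sigma O a * sigma O b :=
  (mk_rel (.sigma_add a b)).trans (map_mul _ _ _)

theorem sigma_coef (a : Fin (n + 1) → ℤ) (c : KHbar n) :
    sigma O a * coef O c = coef O (shift a c) * sigma O a :=
  (map_mul _ _ _).symm.trans ((mk_rel (.sigma_coef a c)).trans (map_mul _ _ _))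

theorem sigma_func (a : Fin (n + 1) → ℤ) (g : O) :
    sigma O a * func n g = func n g * sigma O a :=
  (map_mul _ _ _).symm.trans ((mk_rel (.sigma_func a g)).trans (map_mul _ _ _))

theorem sigma_vf (a : Fin (n + 1) → ℤ) (θ : Derivation ℂ O O) :
    sigma O a * vf n θ = vf n θ * sigma O a :=
  (map_mul _ _ _).symm.trans ((mk_rel (.sigma_vf a θ)).trans (map_mul _ _ _))

variable (O n) in
/-- The inclusion of `K⟦ħ⟧` into `DD_⟦ħ⟧`. -/
def coefHom : KHbar n →ₐ[ℂ] DD O n where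
  toFun := coef O
  map_one' := coef_one
  map_mul' := coef_mul
  map_zero' := by simpa using coef_algebraMap (O := O) (n := n) 0
  map_add' := coef_add
  commutes' := coef_algebraMap

variable (O n) in
/-- The inclusion of `O` into `DD_⟦ħ⟧`. -/
def funcHom : O →+* DD O n where
  toFun := func n
  map_one' := by simpa using func_algebraMap (O := O) (n := n) 1
  map_mul' := func_mul
  map_zero' := by simpa using func_algebraMap (O := O) (n := n) 0
  map_add' := func_add

/-- Induction on elements of `DD_⟦ħ⟧`. -/
theorem induction_gen {p : DD O n → Prop} (algebraMap : ∀ r, p (algebraMap ℂ (DD O n) r))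
    (gen : ∀ g, p (gen O n g)) (add : ∀ x y, p x → p y → p (x + y))
    (mul : ∀ x y, p x → p y → p (x * y)) (x : DD O n) : p x := by
  obtain ⟨x, rfl⟩ := mk_surjective x
  induction x using FreeAlgebra.induction with
  | grade0 r => simpa using algebraMap r
  | grade1 g => exact gen g
  | add x y hx hy => simpa using add _ _ hx hy
  | mul x y hx hy => simpa using mul _ _ hx hy

end DD

/-! ### `O[x^±¹][1/f]` as a quotient of the Laurent polynomials in `σ` -/

variable (O n) in
/-- Laurent polynomials over `O` in symbols `σ_{ν₀}, …, σ_{νₙ}`. -/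
abbrev DiffPoly : Type _ := AddMonoidAlgebra O (Fin (n + 1) → ℤ)

variable (O n) in
/-- The inclusion of the commutative ring of difference operators with coefficients in `O`. -/
def diffEval : DiffPoly O n →+* DD O n :=
  AddMonoidAlgebra.liftNCRingHom (DD.funcHom O n)
    { toFun := fun a => DD.sigma O a.toAdd
      map_one' := DD.sigma_zero
      map_mul' := fun _ _ => DD.sigma_add _ _ }
    fun g a => (DD.sigma_func a.toAdd g).symm

theorem diffEval_single (a : Fin (n + 1) → ℤ) (g : O) :
    diffEval O n (AddMonoidAlgebra.single a g) = DD.func n g * DD.sigma O a :=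
  AddMonoidAlgebra.liftNCRingHom_single _ _ _ _ _

theorem diffEval_single_one (a : Fin (n + 1) → ℤ) :
    diffEval O n (AddMonoidAlgebra.single a 1) = DD.sigma O a := by
  rw [diffEval_single, show DD.func n (1 : O) = 1 from map_one (DD.funcHom O n), one_mul]

/-- The exponents of `x₁, …, xₙ` as exponents of `σ_{ν₁}, …, σ_{νₙ}`. -/
def consZero (n : ℕ) : (Fin n → ℤ) →+ (Fin (n + 1) → ℤ) where
  toFun α := Fin.cons 0 α
  map_zero' := by ext i; refine Fin.cases ?_ (fun _ => ?_) i <;> simp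
  map_add' α β := by ext i; refine Fin.cases ?_ (fun _ => ?_) i <;> simp

variable (O n) in
/-- The inclusion `xⱼ ↦ σ_{νⱼ}`. -/
def laurentIncl : Laurent O n →ₐ[O] DiffPoly O n :=
  AddMonoidAlgebra.mapDomainAlgHom O O (consZero n)

theorem laurentIncl_single (α : Fin n → ℤ) (g : O) :
    laurentIncl O n (AddMonoidAlgebra.single α g) =
      AddMonoidAlgebra.single (Fin.cons 0 α) g :=
  AddMonoidAlgebra.mapDomain_single

/-- Places the operators `p(σ_ν; z)` in the image of a commutative ring, so that the generators of
`J` can be rearranged by commutative algebra. -/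
theorem evalSigma_eq (p : Laurent O n) : DD.evalSigma p = diffEval O n (laurentIncl O n p) := by
  induction p using AddMonoidAlgebra.induction_linear with
  | zero => simp [DD.evalSigma]
  | add p q hp hq =>
    rw [map_add, map_add, ← hp, ← hq, DD.evalSigma, AddMonoidAlgebra.coeff_add]
    exact Finsupp.sum_add_index'
      (fun α => by rw [show DD.func n (0 : O) = 0 from map_zero (DD.funcHom O n), zero_mul])
      (fun α c d => by rw [DD.func_add, add_mul])
  | single α c =>
    rw [laurentIncl_single, diffEval_single, DD.evalSigma, AddMonoidAlgebra.coeff_single]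
    exact Finsupp.sum_single_index
      (by rw [show DD.func n (0 : O) = 0 from map_zero (DD.funcHom O n), zero_mul])

theorem unitMonomial_zero {L : Type*} [CommRing L] (u : Fin (n + 1) → Lˣ) :
    unitMonomial u 0 = 1 := by
  simp [unitMonomial]

theorem unitMonomial_add {L : Type*} [CommRing L] (u : Fin (n + 1) → Lˣ)
    (a b : Fin (n + 1) → ℤ) : unitMonomial u (a + b) = unitMonomial u a * unitMonomial u b := by
  simp [unitMonomial, zpow_add, Finset.prod_mul_distrib]

theorem unitMonomial_single {L : Type*} [CommRing L] (u : Fin (n + 1) → Lˣ)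
    (i : Fin (n + 1)) (k : ℤ) : unitMonomial u (Pi.single i k) = u i ^ k := by
  rw [unitMonomial, Finset.prod_eq_single i]
  · simp
  · intro j _ hj
    simp [hj]
  · simp

/-- The substitution `σ_{νᵢ} ↦ uᵢ`, that is, `σ_{ν₀} ↦ 1/f` and `σ_{νⱼ} ↦ xⱼ`. -/
def complEval (f : Laurent O n) : DiffPoly O n →ₐ[O] Compl f :=
  AddMonoidAlgebra.lift O (Compl f) (Fin (n + 1) → ℤ)
    { toFun := fun a => (unitMonomial (eulerUnit f) a.toAdd : Compl f)
      map_one' := by simp [unitMonomial_zero]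
      map_mul' := fun a b => by simp [unitMonomial_add] }

theorem complEval_single (f : Laurent O n) (a : Fin (n + 1) → ℤ) (g : O) :
    complEval f (AddMonoidAlgebra.single a g) =
      algebraMap O (Compl f) g * (unitMonomial (eulerUnit f) a : Compl f) := by
  rw [complEval, AddMonoidAlgebra.lift_single, Algebra.smul_def]
  rfl

theorem eulerUnit_zero (f : Laurent O n) : eulerUnit f 0 = (fUnit f)⁻¹ := rfl

theorem eulerUnit_succ (f : Laurent O n) (j : Fin n) : eulerUnit f j.succ = xUnit f j := rfl

/-- Homomorphisms out of the group of monomials are determined by the variables. -/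
theorem prod_zpow_hom {G : Type*} [CommGroup G] {m : ℕ} (F : Multiplicative (Fin m → ℤ) →* G)
    (a : Fin m → ℤ) :
    F (Multiplicative.ofAdd a) = ∏ i, F (Multiplicative.ofAdd (Pi.single i 1)) ^ a i := by
  simp only [← map_zpow, ← map_prod]
  congr 1
  apply Multiplicative.toAdd.injective
  rw [toAdd_prod]
  ext i
  simp [Finset.sum_apply, Pi.single_apply]

variable (O n) in
/-- The monomials as units of the ring of Laurent polynomials in `σ`. -/
def monomialHom : Multiplicative (Fin (n + 1) → ℤ) →* (DiffPoly O n)ˣ :=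
  (AddMonoidAlgebra.of O (Fin (n + 1) → ℤ)).toHomUnits

/-- Both sides are homomorphisms from `ℤⁿ` to the units, and they agree on the variables. -/
theorem unitMonomial_cons (f : Laurent O n) (α : Fin n → ℤ) :
    (unitMonomial (eulerUnit f) (Fin.cons 0 α) : Compl f) =
      algebraMap (Laurent O n) (Compl f) (AddMonoidAlgebra.single α 1) := by
  let F : Multiplicative (Fin n → ℤ) →* (Compl f)ˣ :=
    ((algebraMap (Laurent O n) (Compl f) : Laurent O n →* Compl f).comp
      (AddMonoidAlgebra.of O (Fin n → ℤ))).toHomUnits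
  have hF : ∀ i, F (Multiplicative.ofAdd (Pi.single i 1)) = xUnit f i := fun i => Units.ext rfl
  have h : F (Multiplicative.ofAdd α) = unitMonomial (eulerUnit f) (Fin.cons 0 α) := by
    rw [prod_zpow_hom, unitMonomial, Fin.prod_univ_succ]
    simp [hF, eulerUnit_succ]
  rw [← h]
  rfl

theorem complEval_laurentIncl (f p : Laurent O n) :
    complEval f (laurentIncl O n p) = algebraMap (Laurent O n) (Compl f) p := by
  induction p using AddMonoidAlgebra.induction_linear with
  | zero => simp
  | add p q hp hq => simp only [map_add, hp, hq]
  | single α g =>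
    rw [laurentIncl_single, complEval_single, unitMonomial_cons,
      IsScalarTower.algebraMap_apply O (Laurent O n) (Compl f), ← map_mul]
    congr 1
    refine (AddMonoidAlgebra.single_mul_single 0 α g 1).trans ?_
    simp

/-- A fraction `p/f^k` is the value of `p(σ_ν) σ_{ν₀}^k`. -/
theorem complEval_surjective (f : Laurent O n) : Function.Surjective (complEval f) := by
  intro l
  obtain ⟨⟨p, _, k, rfl⟩, hs⟩ := IsLocalization.surj (Submonoid.powers f) l
  refine ⟨laurentIncl O n p * AddMonoidAlgebra.single (Pi.single 0 (k : ℤ)) 1, ?_⟩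
  rw [map_mul, complEval_laurentIncl, complEval_single, unitMonomial_single, eulerUnit_zero,
    map_one, one_mul, ← hs]
  have : (algebraMap (Laurent O n) (Compl f)) (f ^ k) = ((fUnit f ^ k : (Compl f)ˣ) : Compl f) := by
    rw [map_pow, Units.val_pow_eq_pow_val]
    rfl
  rw [this, zpow_natCast, inv_pow, mul_assoc, Units.mul_inv, mul_one]

/-- The equation `σ_{ν₀} f(σ_ν) = 1`. -/
def complRel (f : Laurent O n) : DiffPoly O n :=
  1 - AddMonoidAlgebra.single (Pi.single 0 1) 1 * laurentIncl O n f

/-- Modulo `complRel f` the element `f(σ_ν)` becomes invertible with inverse `σ_{ν₀}`, so the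
universal property of the localization gives a map `r` from `Compl f` to the quotient. Composed with
the evaluation, `r` is the quotient map, so whatever evaluates to zero lies in the principal ideal.
-/
theorem exists_of_complEval_eq_zero (f : Laurent O n) (P : DiffPoly O n)
    (hP : complEval f P = 0) : ∃ R, P = R * complRel f := by
  let I : Ideal (DiffPoly O n) := Ideal.span {complRel f}
  let q : DiffPoly O n →+* DiffPoly O n ⧸ I := Ideal.Quotient.mk I
  have hq : q (AddMonoidAlgebra.single (Pi.single 0 1) 1) * q (laurentIncl O n f) = 1 := by
    rw [← map_mul, ← map_one q, eq_comm, Ideal.Quotient.eq]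
    exact Ideal.mem_span_singleton_self _
  let g : Laurent O n →+* DiffPoly O n ⧸ I := q.comp (laurentIncl O n : Laurent O n →+* _)
  have hg : IsUnit (g f) := IsUnit.of_mul_eq_one _ ((mul_comm _ _).trans hq)
  let r : Compl f →+* DiffPoly O n ⧸ I := IsLocalization.Away.lift f hg
  have hr : ∀ p, r (algebraMap _ _ p) = q (laurentIncl O n p) := IsLocalization.Away.lift_eq f hg
  have hunit : ∀ i, Units.map (r : Compl f →* _) (eulerUnit f i) =
      Units.map (q : _ →* DiffPoly O n ⧸ I)
        (monomialHom O n (Multiplicative.ofAdd (Pi.single i 1))) := by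
    intro i
    refine Fin.cases ?_ (fun j => ?_) i
    -- For `u₀ = 1/f` the claim is the defining relation `σ_{ν₀} f(σ_ν) = 1` of the quotient.
    · rw [eulerUnit_zero, map_inv, inv_eq_iff_mul_eq_one]
      refine Units.ext ((mul_comm _ _).trans (Eq.trans ?_ hq))
      exact congrArg _ (hr f)
    · refine Units.ext ((hr _).trans ?_)
      rw [laurentIncl_single]
      change _ = q (AddMonoidAlgebra.single (Pi.single j.succ 1) 1)
      congr 2
      ext i
      refine Fin.cases ?_ (fun i => ?_) i
      · simp
      · simp [Pi.single_apply]
  have hmon : ∀ a, Units.map (r : Compl f →* _) (unitMonomial (eulerUnit f) a) =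
      Units.map (q : _ →* DiffPoly O n ⧸ I) (monomialHom O n (Multiplicative.ofAdd a)) := by
    intro a
    rw [prod_zpow_hom (monomialHom O n) a, unitMonomial, map_prod, map_prod]
    simp only [map_zpow, hunit]
  have key : ∀ P, r (complEval f P) = q P := by
    intro P
    induction P using AddMonoidAlgebra.induction_linear with
    | zero => simp
    | add P Q hP hQ => simp only [map_add, hP, hQ]
    | single a c =>
      have h1 : r (unitMonomial (eulerUnit f) a : Compl f) =
          q (AddMonoidAlgebra.single a 1) := congrArg Units.val (hmon a)
      have h2 : r (algebraMap O (Compl f) c) = q (AddMonoidAlgebra.single 0 c) := by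
        rw [IsScalarTower.algebraMap_apply O (Laurent O n) (Compl f), hr]
        exact congrArg q ((laurentIncl O n).commutes c)
      rw [complEval_single, map_mul, h1, h2, ← map_mul, AddMonoidAlgebra.single_mul_single,
        zero_add, mul_one]
  have h0 := key P
  rw [hP, map_zero, eq_comm, Ideal.Quotient.eq_zero_iff_mem, Ideal.mem_span_singleton'] at h0
  obtain ⟨R, hR⟩ := h0
  exact ⟨R, hR.symm⟩

end Evaluation

/-! ### Explicit action of `DD` and of `∇ⱼ` on functions -/

section Action

variable {O : Type*} [CommRing O] [Algebra ℂ O] {n : ℕ} {f : Laurent O n}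

theorem coef_smul_tmul (c c' : KHbar n) (l : Compl f) :
    DD.coef O c • FunRing.tmul l c' = FunRing.tmul l (c * c') := by
  rw [smul_def, DD.coef, action_gen]
  exact (Algebra.TensorProduct.tmul_mul_tmul _ _ _ _).trans (by rw [one_mul]; rfl)

theorem func_smul_tmul (g : O) (c : KHbar n) (l : Compl f) :
    DD.func n g • FunRing.tmul l c = FunRing.tmul (algebraMap O (Compl f) g * l) c := by
  rw [smul_def, DD.func, action_gen]
  exact (Algebra.TensorProduct.tmul_mul_tmul _ _ _ _).trans (by rw [one_mul]; rfl)

theorem sigma_smul_tmul (a : Fin (n + 1) → ℤ) (c : KHbar n) (l : Compl f) :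
    DD.sigma O a • FunRing.tmul l c =
      FunRing.tmul ((unitMonomial (eulerUnit f) a : Compl f) * l) (shift a c) := by
  rw [smul_def, DD.sigma, action_gen]
  refine (shiftOp_apply _ _ _).trans ?_
  rw [FunRing.tmul, shiftCoef_tmul]
  exact (Algebra.TensorProduct.tmul_mul_tmul _ _ _ _).trans (by rw [one_mul]; rfl)

theorem FunRing.add_tmul (l l' : Compl f) (c : KHbar n) :
    FunRing.tmul (l + l') c = FunRing.tmul l c + FunRing.tmul l' c :=
  TensorProduct.add_tmul _ _ _

theorem FunRing.zero_tmul (c : KHbar n) : FunRing.tmul (0 : Compl f) c = 0 :=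
  TensorProduct.zero_tmul _ _

theorem FunRing.neg_tmul (l : Compl f) (c : KHbar n) :
    FunRing.tmul (-l) c = -FunRing.tmul l c :=
  TensorProduct.neg_tmul _ _

/-- On functions with constant coefficient `1` the shift `ν ↦ ν + ħa` is invisible, so difference
operators over `O` act by plain multiplication. -/
theorem diffEval_smul_tmul (P : DiffPoly O n) (l : Compl f) :
    diffEval O n P • FunRing.tmul l 1 = FunRing.tmul (complEval f P * l) 1 := by
  induction P using AddMonoidAlgebra.induction_linear with
  | zero => rw [map_zero, zero_smul, map_zero, zero_mul, FunRing.zero_tmul]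
  | add P Q hP hQ => rw [map_add, add_smul, hP, hQ, map_add, add_mul, FunRing.add_tmul]
  | single a g =>
    rw [diffEval_single, mul_smul, sigma_smul_tmul, map_one, func_smul_tmul, complEval_single,
      mul_assoc]

/-- Every function is a combination of translates of a given monomial. -/
theorem FunRing.induction_monomial (b : Fin (n + 1) → ℤ) {p : FunRing f → Prop}
    (zero : p 0) (add : ∀ x y, p x → p y → p (x + y))
    (monomial : ∀ (c : KHbar n) (g : O) (a : Fin (n + 1) → ℤ),
      p ((DD.coef O c * (DD.func n g * DD.sigma O a)) •
        FunRing.tmul (unitMonomial (eulerUnit f) b : Compl f) 1)) (x : FunRing f) : p x := by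
  change KHbarAlg (Compl f) n at x
  induction x using TensorProduct.induction_on with
  | zero => exact zero
  | add x y hx hy => exact add x y hx hy
  | tmul l c =>
    change p (FunRing.tmul l c)
    obtain ⟨P, rfl⟩ := complEval_surjective f l
    induction P using AddMonoidAlgebra.induction_linear with
    | zero => rw [map_zero, FunRing.zero_tmul]; exact zero
    | add P Q hP hQ => rw [map_add, FunRing.add_tmul]; exact add _ _ hP hQ
    | single a g =>
      -- The exponent `a - b` cancels the given monomial and leaves the wanted `σ^a`-value.
      have h := monomial c g (a - b)
      rwa [mul_smul, ← diffEval_single, diffEval_smul_tmul, coef_smul_tmul, mul_one,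
        complEval_single, mul_assoc, ← Units.val_mul, ← unitMonomial_add, sub_add_cancel,
        ← complEval_single] at h

/-- Each monomial generates the functions as a `DD`-module. The freedom in `b` matters: `∇ⱼ` is best
tested on `xⱼ/(x₁⋯xₙ)`, not on `1/(x₁⋯xₙ)`. -/
theorem FunRing.linearMap_ext (b : Fin (n + 1) → ℤ) {N : Type*} [AddCommGroup N]
    [Module (DD O n) N] {F G : FunRing f →ₗ[DD O n] N}
    (h : F (FunRing.tmul (unitMonomial (eulerUnit f) b : Compl f) 1) =
      G (FunRing.tmul (unitMonomial (eulerUnit f) b : Compl f) 1)) : F = G := by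
  ext x
  induction x using FunRing.induction_monomial b with
  | zero => simp
  | add x y hx hy => simp only [map_add, hx, hy]
  | monomial c g a => rw [map_smul, map_smul, h]

theorem dlog_fUnit (θ : Derivation ℂ O O) :
    dlog (liftVF f θ) (fUnit f) =
      ((fUnit f)⁻¹ : (Compl f)ˣ) * algebraMap (Laurent O n) (Compl f) (coeffDer n θ f) :=
  congrArg _ (extendDer_algebraMap f _ f)

theorem dlog_inv {L : Type*} [CommRing L] [Algebra ℂ L] (D : Derivation ℂ L L) (u : Lˣ) :
    dlog D u⁻¹ = -dlog D u := by
  have h := dlog_mul D u u⁻¹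
  rw [mul_inv_cancel, show dlog D 1 = 0 by simp [dlog]] at h
  linear_combination -h

theorem omega_eulerUnit (D : Derivation ℂ (Compl f) (Compl f)) :
    omega (eulerUnit f) D =
      (-dlog D (fUnit f)) ⊗ₜ[ℂ] nu 0 + ∑ j : Fin n, dlog D (xUnit f j) ⊗ₜ[ℂ] nu j.succ := by
  rw [omega, Fin.sum_univ_succ, eulerUnit_zero, dlog_inv]
  simp only [eulerUnit_succ]

theorem vf_smul_tmul (θ : Derivation ℂ O O) (l : Compl f) (c : KHbar n) :
    DD.vf n θ • FunRing.tmul l c = FunRing.tmul (liftVF f θ l) (hbar n * c) -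
      FunRing.tmul ((unitMonomial (eulerUnit f) (Pi.single 0 1) : Compl f) *
        algebraMap (Laurent O n) (Compl f) (coeffDer n θ f) * l) (nu 0 * c) := by
  rw [smul_def, DD.vf, action_gen, sub_eq_add_neg, ← FunRing.neg_tmul]
  refine (conn_apply _ _ _).trans ?_
  -- The coordinates `xⱼ` are constant along `θ`, so only `u₀ = 1/f` contributes to `ω(θ)`.
  have h : ∀ j, dlog (liftVF f θ) (xUnit f j) = 0 := fun j => by
    rw [dlog, liftVF_xUnit, mul_zero]
  rw [FunRing.tmul, tensorDer_tmul, omega_eulerUnit, dlog_fUnit, unitMonomial_single,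
    eulerUnit_zero, zpow_one]
  simp only [h, TensorProduct.zero_tmul, Finset.sum_const_zero, add_zero, neg_mul,
    Algebra.TensorProduct.tmul_mul_tmul, one_mul]
  rfl

theorem liftPartial_xUnit (i j : Fin n) :
    liftPartial f j (xUnit f i : Compl f) = if i = j then 1 else 0 := by
  refine (extendDer_algebraMap f _ _).trans ?_
  rw [partialX_single]
  by_cases h : i = j
  · subst h
    simp [← AddMonoidAlgebra.one_def]
  · simp [h, Ne.symm h]

theorem nablaX_tmul (j : Fin n) (l : Compl f) (c : KHbar n) :
    nablaX f j (FunRing.tmul l c) = FunRing.tmul (liftPartial f j l) (hbar n * c) -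
      FunRing.tmul ((unitMonomial (eulerUnit f) (Pi.single 0 1) : Compl f) *
        algebraMap (Laurent O n) (Compl f) (partialX O j f) * l) (nu 0 * c) +
      FunRing.tmul ((((xUnit f j)⁻¹ : (Compl f)ˣ) : Compl f) * l) (nu j.succ * c) := by
  rw [sub_eq_add_neg, ← FunRing.neg_tmul]
  refine (conn_apply _ _ _).trans ?_
  have h : ∀ i, dlog (liftPartial f j) (xUnit f i) =
      if i = j then (((xUnit f j)⁻¹ : (Compl f)ˣ) : Compl f) else 0 := fun i => by
    rw [dlog, liftPartial_xUnit]
    split_ifs with hij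
    · rw [hij, mul_one]
    · rw [mul_zero]
  have hf : dlog (liftPartial f j) (fUnit f) =
      ((fUnit f)⁻¹ : (Compl f)ˣ) * algebraMap (Laurent O n) (Compl f) (partialX O j f) :=
    congrArg _ (extendDer_algebraMap f _ f)
  rw [FunRing.tmul, tensorDer_tmul, omega_eulerUnit, hf, unitMonomial_single,
    eulerUnit_zero, zpow_one, Finset.sum_eq_single j (fun i _ hi => by
      rw [h, if_neg hi, TensorProduct.zero_tmul]) (by simp), h, if_pos rfl]
  simp only [add_mul, neg_mul, Algebra.TensorProduct.tmul_mul_tmul, one_mul, ← add_assoc]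
  rfl

end Action

/-! ### The map from functions to the hypergeometric module -/

section Inverse

variable {O : Type*} [CommRing O] [Algebra ℂ O] {n : ℕ}

theorem consZero_single (j : Fin n) (k : ℤ) :
    consZero n (Pi.single j k) = Pi.single j.succ k := by
  ext i
  refine Fin.cases ?_ (fun i => ?_) i
  · simp [consZero]
  · simp [consZero, Pi.single_apply]

/-- The coefficient `1/(x₁ ⋯ xₙ)` of the form `dx₁/x₁ ∧ ⋯ ∧ dxₙ/xₙ`. -/
def dlogCoef (f : Laurent O n) : Compl f :=
  (unitMonomial (eulerUnit f) (consZero n (-1)) : Compl f)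

theorem complEval_dlogCoef (f : Laurent O n) :
    complEval f (AddMonoidAlgebra.single (consZero n (-1)) 1) = dlogCoef f := by
  rw [complEval_single, map_one, one_mul, dlogCoef]

/-- The class of `1` in the hypergeometric module. -/
def hypOne (f : Laurent O n) : DD.MHyp f := Submodule.Quotient.mk 1

theorem smul_hypOne_eq_zero {f : Laurent O n} {P : DD O n} (hP : P ∈ DD.J f) :
    P • hypOne f = 0 := by
  rw [hypOne, ← Submodule.Quotient.mk_smul, smul_eq_mul, mul_one]
  exact (Submodule.Quotient.mk_eq_zero _).mpr hP

theorem complRel_smul_hypOne (f : Laurent O n) : diffEval O n (complRel f) • hypOne f = 0 := by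
  rw [complRel, map_sub, map_one, map_mul, ← evalSigma_eq, diffEval_single_one]
  exact smul_hypOne_eq_zero (Submodule.subset_span (Or.inl (Or.inl rfl)))

/-- The relation for `νⱼ`, with `σ_{νⱼ}` moved to the right so as to match
`nablaX_xUnit_mul_dlogCoef` term by term. -/
theorem nu_smul_hypOne (f : Laurent O n) (j : Fin n) :
    DD.coef O (nu (n := n) j.succ) • hypOne f = DD.coef O (nu (n := n) 0) • diffEval O n
      (AddMonoidAlgebra.single (Pi.single 0 1) 1 * laurentIncl O n (partialX O j f) *
        AddMonoidAlgebra.single (Pi.single j.succ 1) 1) • hypOne f := by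
  rw [mul_right_comm, map_mul, map_mul, ← evalSigma_eq, diffEval_single_one, diffEval_single_one,
    ← mul_smul, ← mul_assoc, ← mul_assoc, ← sub_eq_zero, ← sub_smul]
  exact smul_hypOne_eq_zero (Submodule.subset_span (Or.inl (Or.inr ⟨j, rfl⟩)))

theorem vf_smul_hypOne (f : Laurent O n) (θ : Derivation ℂ O O) :
    DD.vf n θ • hypOne f = -(DD.coef O (nu (n := n) 0) • diffEval O n
      (AddMonoidAlgebra.single (Pi.single 0 1) 1 * laurentIncl O n (coeffDer n θ f)) •
        hypOne f) := by
  rw [map_mul, ← evalSigma_eq, diffEval_single_one,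
    ← mul_smul, ← mul_assoc, eq_neg_iff_add_eq_zero, ← add_smul]
  exact smul_hypOne_eq_zero (Submodule.subset_span (Or.inr ⟨θ, rfl⟩))

/-- The additive map underlying `complToHyp`, on Laurent polynomials in `σ`. -/
def diffPolyToHyp (f : Laurent O n) : DiffPoly O n →+ DD.MHyp f where
  -- The extra factor `σ_{ν₁}⋯σ_{νₙ}` passes from coefficients of `dx₁ ∧ ⋯ ∧ dxₙ` to coefficients of
  -- `dx₁/x₁ ∧ ⋯ ∧ dxₙ/xₙ`.
  toFun P := diffEval O n (P * AddMonoidAlgebra.single (consZero n 1) 1) • hypOne f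
  map_zero' := by rw [zero_mul, map_zero, zero_smul]
  map_add' P Q := by rw [add_mul, map_add, add_smul]

theorem diffPolyToHyp_eq_zero {f : Laurent O n} {P : DiffPoly O n} (hP : complEval f P = 0) :
    diffPolyToHyp f P = 0 := by
  obtain ⟨R, rfl⟩ := exists_of_complEval_eq_zero f P hP
  change diffEval O n (R * complRel f * AddMonoidAlgebra.single (consZero n 1) 1) • hypOne f = 0
  -- `J` is only a left ideal; commutativity of the Laurent polynomials in `σ` brings the relation
  -- next to `[1]`.
  rw [mul_right_comm, map_mul, mul_smul, complRel_smul_hypOne, smul_zero]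

/-- The map sending a function `g f^(-k) x^α` to the class of `g σ_s^k σ_ν^(α + 1)`. -/
def complToHyp (f : Laurent O n) : Compl f →+ DD.MHyp f :=
  AddMonoidHom.liftOfSurjective (complEval f : DiffPoly O n →+ Compl f) (complEval_surjective f)
    ⟨diffPolyToHyp f, fun _ h => diffPolyToHyp_eq_zero h⟩

theorem complToHyp_complEval (f : Laurent O n) (P : DiffPoly O n) :
    complToHyp f (complEval f P) =
      diffEval O n (P * AddMonoidAlgebra.single (consZero n 1) 1) • hypOne f :=
  AddMonoidHom.liftOfRightInverse_comp_apply (complEval f : DiffPoly O n →+ Compl f) _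
    (Function.rightInverse_surjInv (complEval_surjective f))
    ⟨diffPolyToHyp f, fun _ h => diffPolyToHyp_eq_zero h⟩ P

theorem complToHyp_mul (f : Laurent O n) (P : DiffPoly O n) (l : Compl f) :
    complToHyp f (complEval f P * l) = diffEval O n P • complToHyp f l := by
  obtain ⟨Q, rfl⟩ := complEval_surjective f l
  rw [← map_mul, complToHyp_complEval, complToHyp_complEval, mul_assoc, map_mul, mul_smul]

theorem complToHyp_dlogCoef (f : Laurent O n) : complToHyp f (dlogCoef f) = hypOne f := by
  rw [← complEval_dlogCoef, complToHyp_complEval, AddMonoidAlgebra.single_mul_single, ← map_add,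
    neg_add_cancel, map_zero, one_mul, ← AddMonoidAlgebra.one_def, map_one, one_smul]

theorem complToHyp_func (f : Laurent O n) (g : O) (l : Compl f) :
    complToHyp f (algebraMap O (Compl f) g * l) = DD.func n g • complToHyp f l := by
  have h := complToHyp_mul f (AddMonoidAlgebra.single 0 g) l
  rwa [complEval_single, unitMonomial_zero, Units.val_one, mul_one, diffEval_single,
    DD.sigma_zero, mul_one] at h

theorem complToHyp_sigma (f : Laurent O n) (a : Fin (n + 1) → ℤ) (l : Compl f) :
    complToHyp f ((unitMonomial (eulerUnit f) a : Compl f) * l) =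
      DD.sigma O a • complToHyp f l := by
  have h := complToHyp_mul f (AddMonoidAlgebra.single a 1) l
  rwa [complEval_single, map_one, one_mul, diffEval_single_one] at h

/-- The additive map underlying `funToHyp`. -/
def funToHypHom (f : Laurent O n) : FunRing f →+ DD.MHyp f :=
  TensorProduct.liftAddHom (R := ℂ) (M := Compl f) (N := KHbar n)
    { toFun := fun l =>
        { toFun := fun c => DD.coef O c • complToHyp f l
          map_zero' := by rw [show DD.coef O (0 : KHbar n) = 0 from map_zero (DD.coefHom O n),
            zero_smul]
          map_add' := fun c d => by rw [DD.coef_add, add_smul] }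
      map_zero' := by ext c; simp
      map_add' := fun l l' => by ext c; simp }
    -- Balancedness over `ℂ`: a complex scalar is the same element of `DD` whether it comes from `O`
    -- or from `K⟦ħ⟧`.
    fun r l c => by
      change DD.coef O c • complToHyp f (r • l) = DD.coef O (r • c) • complToHyp f l
      rw [Algebra.smul_def, Algebra.smul_def, IsScalarTower.algebraMap_apply ℂ O (Compl f),
        complToHyp_func, mul_comm, DD.coef_mul, DD.coef_algebraMap, DD.func_algebraMap, mul_smul]

theorem funToHypHom_tmul (f : Laurent O n) (l : Compl f) (c : KHbar n) :
    funToHypHom f (FunRing.tmul l c) = DD.coef O c • complToHyp f l := rfl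

theorem FunRing.induction_tmul {f : Laurent O n} {p : FunRing f → Prop} (zero : p 0)
    (add : ∀ x y, p x → p y → p (x + y)) (tmul : ∀ l c, p (FunRing.tmul l c)) (x : FunRing f) :
    p x :=
  TensorProduct.induction_on x zero tmul add

theorem funToHypHom_coef (f : Laurent O n) (c : KHbar n) (x : FunRing f) :
    funToHypHom f (DD.coef O c • x) = DD.coef O c • funToHypHom f x := by
  induction x using FunRing.induction_tmul with
  | zero => simp
  | add x y hx hy => simp only [smul_add, map_add, hx, hy]
  | tmul l c' => rw [coef_smul_tmul, funToHypHom_tmul, funToHypHom_tmul, DD.coef_mul, mul_smul]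

theorem funToHypHom_func (f : Laurent O n) (g : O) (x : FunRing f) :
    funToHypHom f (DD.func n g • x) = DD.func n g • funToHypHom f x := by
  induction x using FunRing.induction_tmul with
  | zero => simp
  | add x y hx hy => simp only [smul_add, map_add, hx, hy]
  | tmul l c =>
    rw [func_smul_tmul, funToHypHom_tmul, funToHypHom_tmul, complToHyp_func, ← mul_smul,
      ← mul_smul, DD.coef_func]

theorem funToHypHom_sigma (f : Laurent O n) (a : Fin (n + 1) → ℤ) (x : FunRing f) :
    funToHypHom f (DD.sigma O a • x) = DD.sigma O a • funToHypHom f x := by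
  induction x using FunRing.induction_tmul with
  | zero => simp
  | add x y hx hy => simp only [smul_add, map_add, hx, hy]
  | tmul l c =>
    rw [sigma_smul_tmul, funToHypHom_tmul, funToHypHom_tmul, complToHyp_sigma, ← mul_smul,
      ← mul_smul, DD.sigma_coef]

/-- `θ` differentiates coefficients only, and `1/(x₁⋯xₙ)` is a monomial with coefficient `1`. -/
theorem liftVF_dlogCoef (f : Laurent O n) (θ : Derivation ℂ O O) :
    liftVF f θ (dlogCoef f) = 0 := by
  rw [dlogCoef]
  refine (congrArg _ (unitMonomial_cons f (-1))).trans ((extendDer_algebraMap f _ _).trans ?_)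
  rw [coeffDer_single]
  simp

/-- The counterpart of `vf_smul_hypOne`; it holds for the function itself, before passing to
cohomology. -/
theorem vf_smul_dlogCoef (f : Laurent O n) (θ : Derivation ℂ O O) :
    DD.vf n θ • FunRing.tmul (dlogCoef f) 1 = -(DD.coef O (nu (n := n) 0) • diffEval O n
      (AddMonoidAlgebra.single (Pi.single 0 1) 1 * laurentIncl O n (coeffDer n θ f)) •
        FunRing.tmul (dlogCoef f) 1) := by
  rw [vf_smul_tmul, liftVF_dlogCoef, FunRing.zero_tmul, zero_sub, diffEval_smul_tmul,
    coef_smul_tmul, map_mul, complEval_laurentIncl, complEval_single, map_one, one_mul]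

theorem funToHypHom_diffEval_dlogCoef (f : Laurent O n) (P : DiffPoly O n) :
    funToHypHom f (diffEval O n P • FunRing.tmul (dlogCoef f) 1) =
      diffEval O n P • hypOne f := by
  rw [diffEval_smul_tmul, funToHypHom_tmul, complToHyp_mul, complToHyp_dlogCoef, DD.coef_one,
    one_smul]

theorem funToHypHom_dlogCoef (f : Laurent O n) :
    funToHypHom f (FunRing.tmul (dlogCoef f) 1) = hypOne f := by
  rw [funToHypHom_tmul, complToHyp_dlogCoef, DD.coef_one, one_smul]

/-- Writing functions as translates of `1/(x₁⋯xₙ)` reduces the claim to this generator, where the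
relations on both sides coincide. -/
theorem funToHypHom_vf (f : Laurent O n) (θ : Derivation ℂ O O) (x : FunRing f) :
    funToHypHom f (DD.vf n θ • x) = DD.vf n θ • funToHypHom f x := by
  induction x using FunRing.induction_monomial (consZero n (-1)) with
  | zero => simp
  | add x y hx hy => simp only [smul_add, map_add, hx, hy]
  | monomial c g a =>
    change funToHypHom f (_ • _ • FunRing.tmul (dlogCoef f) 1) =
      _ • funToHypHom f (_ • FunRing.tmul (dlogCoef f) 1)
    have hcomm : DD.vf n θ * (DD.coef O c * (DD.func n g * DD.sigma O a)) =
        DD.coef O c * (DD.func n g * (DD.sigma O a * DD.vf n θ)) +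
          DD.coef O c * (DD.coef O (hbar n) * (DD.func n (θ g) * DD.sigma O a)) := by
      rw [← mul_assoc, DD.vf_coef, mul_assoc, ← mul_assoc (DD.vf n θ), DD.vf_func, add_mul,
        mul_add, mul_assoc, mul_assoc, DD.sigma_vf]
    have h0 : funToHypHom f (DD.vf n θ • FunRing.tmul (dlogCoef f) 1) =
        DD.vf n θ • hypOne f := by
      rw [vf_smul_dlogCoef, map_neg, funToHypHom_coef, funToHypHom_diffEval_dlogCoef,
        vf_smul_hypOne]
    rw [← mul_smul, hcomm]
    simp only [add_smul, mul_smul, map_add, funToHypHom_coef, funToHypHom_func,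
      funToHypHom_sigma, h0, funToHypHom_dlogCoef]
    -- The same commutation rule, now in the target module, reassembles the right-hand side.
    simp only [← mul_smul, ← add_smul, hcomm]

/-- The `DD_⟦ħ⟧`-linear map from functions to the hypergeometric module sending `1/(x₁ ⋯ xₙ)` to
the class of `1`. -/
def funToHyp (f : Laurent O n) : FunRing f →ₗ[DD O n] DD.MHyp f where
  toFun := funToHypHom f
  map_add' := map_add _
  map_smul' P x := by
    rw [RingHom.id_apply]
    induction P using DD.induction_gen generalizing x with
    | algebraMap r => rw [← DD.coef_algebraMap, funToHypHom_coef]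
    | gen g =>
      cases g with
      | coef c => exact funToHypHom_coef f c x
      | func g => exact funToHypHom_func f g x
      | vf θ => exact funToHypHom_vf f θ x
      | sigma a => exact funToHypHom_sigma f a x
    | add P Q hP hQ => rw [add_smul, map_add, hP, hQ, add_smul]
    | mul P Q hP hQ => rw [mul_smul, hP, hQ, mul_smul]

theorem funToHyp_dlogCoef (f : Laurent O n) :
    funToHyp f (FunRing.tmul (dlogCoef f) 1) = hypOne f :=
  funToHypHom_dlogCoef f

theorem unitMonomial_add_dlogCoef (f : Laurent O n) (j : Fin n) :
    (unitMonomial (eulerUnit f) (consZero n (Pi.single j 1 + -1)) : Compl f) =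
      xUnit f j * dlogCoef f := by
  rw [map_add, unitMonomial_add, Units.val_mul, consZero_single, unitMonomial_single,
    eulerUnit_succ, zpow_one, dlogCoef]

/-- The monomial `xⱼ/(x₁⋯xₙ)` does not involve `xⱼ`, so the term `ħ ∂/∂xⱼ` vanishes and only the
product with `ω(∂/∂xⱼ)` survives. The result is the `νⱼ` generator of `J` applied to `1/(x₁⋯xₙ)`. -/
theorem nablaX_xUnit_mul_dlogCoef (f : Laurent O n) (j : Fin n) :
    nablaX f j (FunRing.tmul (xUnit f j * dlogCoef f) 1) =
      DD.coef O (nu (n := n) j.succ) • FunRing.tmul (dlogCoef f) 1 -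
        DD.coef O (nu (n := n) 0) • diffEval O n
          (AddMonoidAlgebra.single (Pi.single 0 1) 1 * laurentIncl O n (partialX O j f) *
            AddMonoidAlgebra.single (Pi.single j.succ 1) 1) •
              FunRing.tmul (dlogCoef f) 1 := by
  have h : liftPartial f j (xUnit f j * dlogCoef f) = 0 := by
    rw [← unitMonomial_add_dlogCoef]
    refine (congrArg _ (unitMonomial_cons f _)).trans ((extendDer_algebraMap f _ _).trans ?_)
    rw [partialX_single]
    simp
  rw [nablaX_tmul, h, FunRing.zero_tmul, diffEval_smul_tmul, coef_smul_tmul, coef_smul_tmul,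
    map_mul, map_mul, complEval_laurentIncl, complEval_single, complEval_single, map_one, one_mul,
    one_mul, unitMonomial_single _ j.succ, eulerUnit_succ, zpow_one, mul_assoc _ _ (dlogCoef f),
    Units.inv_mul_cancel_left]
  abel

theorem funToHyp_comp_nablaX (f : Laurent O n) (j : Fin n) :
    funToHyp f ∘ₗ nablaX f j = 0 := by
  refine FunRing.linearMap_ext (consZero n (Pi.single j 1 + -1)) ?_
  rw [unitMonomial_add_dlogCoef, LinearMap.comp_apply, nablaX_xUnit_mul_dlogCoef, map_sub,
    map_smul, map_smul, map_smul, funToHyp_dlogCoef, nu_smul_hypOne, sub_self,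
    LinearMap.zero_apply]

end Inverse

/-! ### Top cohomology and the two inverse maps -/

section TopDegree

variable {O : Type*} [CommRing O] [Algebra ℂ O] {n : ℕ}

/-- The index of the top degree component. -/
def topIdx (n : ℕ) : {I : Finset (Fin n) // I.card = n} := ⟨Finset.univ, by simp⟩

theorem eq_topIdx (I : {I : Finset (Fin n) // I.card = n}) : I = topIdx n :=
  Subtype.ext (Finset.eq_univ_of_card _ (by rw [I.2, Fintype.card_fin]))

/-- The functions `∑ⱼ ∇ⱼ bⱼ`. -/
def divergences (f : Laurent O n) : Submodule (DD O n) (FunRing f) :=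
  ⨆ j, LinearMap.range (nablaX f j)

theorem nabla_apply (f : Laurent O n) (k : ℕ) (η : Forms f k)
    (J : {I : Finset (Fin n) // I.card = k + 1}) :
    nabla f k η J = ∑ j : {j // j ∈ J.1},
      (-1 : ℤ) ^ (J.1.filter (· < j.1)).card • nablaX f j.1 (η (eraseIdx J j)) := by
  simp [nabla]

/-- An `(n - 1)`-form has one coefficient for each omitted index `j`, and up to sign `∇` applies
`∇ⱼ` to it and sums. For `n = 0` both sides are zero, the supremum being empty. -/
theorem coboundaries_top (f : Laurent O n) :
    coboundaries f n = (divergences f).comap (LinearMap.proj (topIdx n)) := by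
  ext ξ
  rw [Submodule.mem_comap, LinearMap.proj_apply]
  cases n with
  | zero =>
    rw [divergences, iSup_of_empty, Submodule.mem_bot]
    change ξ ∈ (⊥ : Submodule (DD O 0) (Forms f 0)) ↔ _
    rw [Submodule.mem_bot]
    refine ⟨fun h => by rw [h]; rfl, fun h => funext fun I => ?_⟩
    rw [eq_topIdx I, h]
    rfl
  | succ k =>
    change ξ ∈ LinearMap.range (nabla f k) ↔ _
    constructor
    · rintro ⟨η, rfl⟩
      rw [nabla_apply]
      exact Submodule.sum_mem _ fun j _ => zsmul_mem
        ((le_iSup (fun j => LinearMap.range (nablaX f j)) j.1) ⟨_, rfl⟩) _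
    · suffices h : divergences f ≤
          (LinearMap.range (nabla f k)).map (LinearMap.proj (topIdx (k + 1))) by
        intro hξ
        obtain ⟨ζ, hζ, hζξ⟩ := h hξ
        rwa [show ξ = ζ from funext fun I => by rw [eq_topIdx I]; exact hζξ.symm]
      refine iSup_le fun j => ?_
      rintro _ ⟨b, rfl⟩
      have hj : j ∈ (topIdx (k + 1)).1 := Finset.mem_univ j
      let s : ℤ := (-1) ^ ((topIdx (k + 1)).1.filter (· < j)).card
      have hs : s * s = 1 := by rw [← mul_pow]; simp
      -- The preimage of `∇ⱼ b` is the form omitting `dxⱼ` alone; the factor `s = ±1` cancels the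
      -- sign in `∇`.
      refine ⟨_, ⟨Pi.single (eraseIdx (topIdx (k + 1)) ⟨j, hj⟩) (s • b), rfl⟩, ?_⟩
      rw [LinearMap.proj_apply, nabla_apply, Finset.sum_eq_single ⟨j, hj⟩]
      · rw [Pi.single_eq_same, map_zsmul, ← mul_smul, hs, one_smul]
      · intro i _ hi
        rw [Pi.single_eq_of_ne, map_zero, smul_zero]
        intro h
        apply hi
        -- Omitting different indices gives different sets, so no other summand sees this form.
        have h' : (topIdx (k + 1)).1.erase i.1 = (topIdx (k + 1)).1.erase j :=
          congrArg Subtype.val h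
        exact Subtype.ext ((Finset.erase_inj _ i.2).mp h')
      · simp

theorem dlogForm_topIdx (f : Laurent O n) :
    dlogForm f (topIdx n) = FunRing.tmul (dlogCoef f) 1 := by
  have : ((∏ i, (xUnit f i)⁻¹ : (Compl f)ˣ) : Compl f) = dlogCoef f := by
    rw [dlogCoef, unitMonomial, Fin.prod_univ_succ]
    simp [consZero, eulerUnit_succ]
  rw [← this, Units.coe_prod]
  rfl

/-- The map from the top cohomology to the hypergeometric module. -/
def cohomologyToHyp (f : Laurent O n) : Cohomology f n →ₗ[DD O n] DD.MHyp f :=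
  Submodule.liftQ _ (funToHyp f ∘ₗ LinearMap.proj (topIdx n) ∘ₗ Submodule.subtype _) (by
    intro ξ hξ
    have hξ' : (ξ : Forms f n) ∈ coboundaries f n := hξ
    rw [coboundaries_top] at hξ'
    have : divergences f ≤ LinearMap.ker (funToHyp f) := iSup_le fun j =>
      LinearMap.range_le_ker_iff.mpr (funToHyp_comp_nablaX f j)
    exact this hξ')

theorem cohomologyToHyp_dlogClass (f : Laurent O n) :
    cohomologyToHyp f (dlogClass f) = hypOne f := by
  refine Eq.trans ?_ (funToHyp_dlogCoef f)
  exact congrArg (funToHyp f) (dlogForm_topIdx f)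

/-- Reduces vanishing in cohomology to a statement about the single coefficient `1/(x₁⋯xₙ)`. -/
theorem smul_dlogClass_eq_zero {f : Laurent O n} {P : DD O n}
    (hP : P • FunRing.tmul (dlogCoef f) 1 ∈ divergences f) : P • dlogClass f = 0 := by
  refine (Submodule.Quotient.mk_eq_zero _).mpr ?_
  change P • dlogForm f ∈ coboundaries f n
  rw [coboundaries_top, Submodule.mem_comap, map_smul, LinearMap.proj_apply, dlogForm_topIdx]
  exact hP

theorem smul_dlogClass_of_mem {f : Laurent O n} {P : DD O n} (hP : P ∈ DD.J f) :
    P • dlogClass f = 0 := by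
  suffices h : DD.J f ≤ LinearMap.ker (LinearMap.toSpanSingleton (DD O n) _ (dlogClass f)) from
    h hP
  refine Submodule.span_le.mpr fun P hP => LinearMap.mem_ker.mpr ?_
  refine (LinearMap.toSpanSingleton_apply _ _ _ _).trans (smul_dlogClass_eq_zero (P := P) ?_)
  -- The first and third kinds of generators annihilate `1/(x₁⋯xₙ)` itself; only the second kind
  -- needs coboundaries.
  rcases hP with (rfl | ⟨j, rfl⟩) | ⟨θ, rfl⟩
  all_goals
    beta_reduce
    rw [evalSigma_eq, DD.sigmaAt, ← diffEval_single_one]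
  · rw [sub_smul, one_smul, ← map_mul, diffEval_smul_tmul, map_mul, complEval_laurentIncl,
      complEval_single, map_one, one_mul, unitMonomial_single, eulerUnit_zero, zpow_one]
    have : (((fUnit f)⁻¹ : (Compl f)ˣ) : Compl f) * algebraMap (Laurent O n) (Compl f) f = 1 :=
      (fUnit f).inv_mul
    rw [this, one_mul, sub_self]
    exact Submodule.zero_mem _
  · rw [DD.sigmaAt, ← diffEval_single_one, mul_assoc, mul_assoc, ← map_mul, ← map_mul, ← mul_assoc,
      mul_right_comm, sub_smul, mul_smul, ← nablaX_xUnit_mul_dlogCoef]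
    exact (le_iSup (fun j => LinearMap.range (nablaX f j)) j) ⟨_, rfl⟩
  · rw [add_smul, vf_smul_dlogCoef, mul_assoc, ← map_mul, mul_smul, neg_add_cancel]
    exact Submodule.zero_mem _

/-- The map from the hypergeometric module to the top cohomology. -/
def hypToCohomology (f : Laurent O n) : DD.MHyp f →ₗ[DD O n] Cohomology f n :=
  Submodule.liftQ _ (LinearMap.toSpanSingleton (DD O n) _ (dlogClass f))
    fun _ hP => smul_dlogClass_of_mem hP

theorem hypToCohomology_hypOne (f : Laurent O n) : hypToCohomology f (hypOne f) = dlogClass f :=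
  (Submodule.liftQ_apply _ _ _).trans (one_smul _ _)

theorem exists_smul_hypOne {f : Laurent O n} (m : DD.MHyp f) : ∃ P : DD O n, P • hypOne f = m := by
  obtain ⟨P, rfl⟩ := Submodule.Quotient.mk_surjective _ m
  exact ⟨P, by rw [hypOne, ← Submodule.Quotient.mk_smul, smul_eq_mul, mul_one]⟩

theorem exists_smul_dlogCoef {f : Laurent O n} (x : FunRing f) :
    ∃ P : DD O n, P • FunRing.tmul (dlogCoef f) 1 = x := by
  induction x using FunRing.induction_monomial (consZero n (-1)) with
  | zero => exact ⟨0, zero_smul _ _⟩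
  | add x y hx hy =>
    obtain ⟨P, rfl⟩ := hx
    obtain ⟨Q, rfl⟩ := hy
    exact ⟨P + Q, add_smul _ _ _⟩
  | monomial c g a => exact ⟨_, rfl⟩

/-- Cyclicity of the functions passes to the top cohomology, a form of degree `n` being determined
by its one coefficient. -/
theorem exists_smul_dlogClass {f : Laurent O n} (x : Cohomology f n) :
    ∃ P : DD O n, P • dlogClass f = x := by
  obtain ⟨ξ, rfl⟩ := Submodule.Quotient.mk_surjective _ x
  obtain ⟨P, hP⟩ := exists_smul_dlogCoef ((ξ : Forms f n) (topIdx n))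
  refine ⟨P, congrArg Submodule.Quotient.mk (Subtype.ext (funext fun I => ?_))⟩
  rw [eq_topIdx I, ← hP, ← dlogForm_topIdx]
  rfl

end TopDegree

end HbarHyp

end

theorem mainTheorem7 {O : Type*} [CommRing O] [IsDomain O] [Algebra ℂ O] [Algebra.Smooth ℂ O]
    (n : ℕ) (f : AddMonoidAlgebra O (Fin n → ℤ)) (hf : f ≠ 0) :
    ∃ e : HbarHyp.DD.MHyp f ≃ₗ[HbarHyp.DD O n] HbarHyp.Cohomology f n,
      e (Submodule.Quotient.mk 1) = HbarHyp.dlogClass f := by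
  -- Each composite is `DD`-linear and fixes a generator of a cyclic module, hence is the identity.
  refine ⟨LinearEquiv.ofLinearMap (HbarHyp.hypToCohomology f) (HbarHyp.cohomologyToHyp f) ?_ ?_,
    HbarHyp.hypToCohomology_hypOne f⟩
  · refine LinearMap.ext fun x => ?_
    obtain ⟨P, rfl⟩ := HbarHyp.exists_smul_dlogClass x
    rw [map_smul, LinearMap.comp_apply, HbarHyp.cohomologyToHyp_dlogClass,
      HbarHyp.hypToCohomology_hypOne, LinearMap.id_apply]
  · refine LinearMap.ext fun m => ?_
    obtain ⟨P, rfl⟩ := HbarHyp.exists_smul_hypOne m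
    rw [map_smul, LinearMap.comp_apply, HbarHyp.hypToCohomology_hypOne,
      HbarHyp.cohomologyToHyp_dlogClass, LinearMap.id_apply]
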